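/- Let $(M,\omega)$ be a compact Kähler manifold of complex dimension $n$, and let $(L,h)$ be a quantum line bundle on it: a holomorphic line bundle with a smooth hermitian metric $h$ (conjugate linear in the first argument) such that the curvature $F$ of the connection compatible with the metric and the complex structure (given in a local holomorphic frame by $F=\bar\partial\partial\log\hat h$) satisfies $F=-\mathrm{i}\,\omega$. Assume that $L$ is very ample, i.e. its global holomorphic sections have no common zero and define a holomorphic embedding of $M$ into projective space. On the space $\Gamma_{hol}(M,L)$ of global holomorphic sections put the scalar product $\langle s,t\rangle=\int_M h(s,t)\,\Omega$, where $\Omega$ is the positive volume form $\omega^n/n!$. For $x\in M$ and $0\ne q\in L_x$ let $\hat q(s)\in\mathbb C$ be defined by $s(x)=\hat q(s)\,q$, and let the coherent vector $e_q\in\Gamma_{hol}(M,L)$ be the unique section with $\langle e_q,s\rangle=\hat q(s)$ for all $s$. For $m\ge 2$ the cyclic $m$-point function of $M$ is $$\Psi_M^{(m)}(x^{(1)},\dots,x^{(m)})=\frac{\langle e_{q^{(1)}},e_{q^{(2)}}\rangle\,\langle e_{q^{(2)}},e_{q^{(3)}}\rangle\cdots\langle e_{q^{(m)}},e_{q^{(1)}}\rangle}{\|e_{q^{(1)}}\|^2\,\|e_{q^{(2)}}\|^2\cdots\|e_{q^{(m)}}\|^2},\qquad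 0\ne q^{(k)}\in L_{x^{(k)}} .$$ Let $\Psi_{\mathbb P^N}^{(m)}$ be the function defined in the same way from $\mathbb P^N(\mathbb C)$ with the Fubini–Study form and the hyperplane bundle with its standard hermitian metric (represented by $1/(1+\|w\|^2)$ in affine coordinates $w$). Fix an orthonormal basis $s_0,\dots,s_N$ of $\Gamma_{hol}(M,L)$, and let $i:M\to\mathbb P^N(\mathbb C)$, $x\mapsto(s_0(x):\dots:s_N(x))$, be the coherent state embedding. Then for all $m\ge 2$ and all $x^{(1)},\dots,x^{(m)}\in M$: 1. the value $\Psi_M^{(m)}(x^{(1)},\dots,x^{(m)})$ does not depend on the choice of the $q^{(k)}$, and $$\Psi_M^{(m)}(x^{(1)},\dots,x^{(m)})=\Psi_{\mathbb P^N}^{(m)}\bigl(i(x^{(1)}),\dots,i(x^{(m)})\bigr);$$ 2. for arbitrary homogeneous representatives $z^{(k)}\in\mathbb C^{N+1}\setminus\{0\}$ of the points $i(x^{(k)})$, $$\Psi_M^{(m)}(x^{(1)},\dots,x^{(m)})=\frac{\langle z^{(2)},z^{(1)}\rangle\,\langle z^{(3)},z^{(2)}\rangle\cdots\langle z^{(1)},z^{(m)}\rangle}{\|z^{(1)}\|^2\,\|z^{(2)}\|^2\cdots\|z^{(m)}\|^2},$$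 where $\langle\cdot,\cdot\rangle$ is the standard hermitian product of $\mathbb C^{N+1}$, conjugate linear in the first argument; 3. $\Psi_M^{(m)}$ is invariant under cyclic permutations of its arguments. -/

import Mathlib

open Bundle Manifold MeasureTheory Set
open scoped ContDiff LinearAlgebra.Projectivization Topology

noncomputable section

namespace CoherentState

/-! ### Real two-forms on a complex manifold, Kähler forms, the Liouville measure -/

section Forms

variable {n : ℕ} {M : Type*} [TopologicalSpace M] [ChartedSpace (Fin n → ℂ) M]

variable (n M) in
/-- A (not necessarily continuous) field of real alternating two-forms on the tangent spaces of the
complex manifold `M` of complex dimension `n`. -/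
abbrev TwoForm : Type _ :=
  ∀ x : M, TangentSpace 𝓘(ℝ, Fin n → ℂ) x [⋀^Fin 2]→L[ℝ] ℝ

/-- The pullback of a two-form under the inverse of the chart `φ`: its local expression. -/
def localForm (κ : TwoForm n M) (φ : OpenPartialHomeomorph M (Fin n → ℂ)) (z : Fin n → ℂ) :
    (Fin n → ℂ) [⋀^Fin 2]→L[ℝ] ℝ :=
  (κ (φ.symm z)).compContinuousLinearMap
    (mfderiv 𝓘(ℝ, Fin n → ℂ) 𝓘(ℝ, Fin n → ℂ) φ.symm z)

/-- A Kähler form: a smooth closed real two-form which is of type `(1,1)`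
(invariant under the complex structure) and positive. -/
structure IsKahlerForm (κ : TwoForm n M) : Prop where
  smooth : ∀ φ ∈ atlas (Fin n → ℂ) M, ContDiffOn ℝ ∞ (localForm κ φ) φ.target
  closed : ∀ φ ∈ atlas (Fin n → ℂ) M, ∀ z ∈ φ.target, extDeriv (localForm κ φ) z = 0
  invariant : ∀ φ ∈ atlas (Fin n → ℂ) M, ∀ z ∈ φ.target, ∀ u v : Fin n → ℂ,
    localForm κ φ z ![Complex.I • u, Complex.I • v] = localForm κ φ z ![u, v]
  pos : ∀ φ ∈ atlas (Fin n → ℂ) M, ∀ z ∈ φ.target, ∀ u : Fin n → ℂ, u ≠ 0 →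
    0 < localForm κ φ z ![u, Complex.I • u]

/-- The real frame `e₁, i e₁, e₂, i e₂, …` of `ℂⁿ`. -/
def realFrame (n : ℕ) (p : Fin n × Fin 2) : Fin n → ℂ :=
  Pi.single p.1 (if p.2 = 0 then 1 else Complex.I)

/-- The value of `α ∧ ⋯ ∧ α / n!` (`n` factors) on the real frame `e₁, i e₁, e₂, i e₂, …`. -/
def topPower (α : (Fin n → ℂ) [⋀^Fin 2]→L[ℝ] ℝ) : ℝ :=
  (1 / ((n.factorial : ℝ) * 2 ^ n)) * ∑ σ : Equiv.Perm (Fin n × Fin 2),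
    ((Equiv.Perm.sign σ : ℤ) : ℝ) *
      ∏ k : Fin n, α ![realFrame n (σ (k, 0)), realFrame n (σ (k, 1))]

/-- The positive measure on `M` given by the volume form `κ ∧ ⋯ ∧ κ / n!`. Each chart transports
Lebesgue measure, with the local coefficient of the form as density, to a measure on its source;
these measures agree on overlaps, and their supremum is the measure on `M` glued from them. -/
def liouvilleMeasure [MeasurableSpace M] (κ : TwoForm n M) : Measure M :=
  ⨆ φ ∈ atlas (Fin n → ℂ) M,
    ((volume.restrict φ.target).withDensity
      fun z => ENNReal.ofReal |topPower (localForm κ φ z)|).map φ.symm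

end Forms

/-! ### Holomorphic hermitian line bundles -/

section LineBundle

variable {n : ℕ} {M : Type*} [TopologicalSpace M] [ChartedSpace (Fin n → ℂ) M]
  {L : M → Type*} [∀ x, AddCommGroup (L x)] [∀ x, Module ℂ (L x)] [∀ x, TopologicalSpace (L x)]
  [TopologicalSpace (TotalSpace ℂ L)] [FiberBundle ℂ L] [VectorBundle ℂ ℂ L]

variable (n L) in
/-- The space of global holomorphic sections of the line bundle `L`. -/
abbrev HolSection : Type _ := Cₛ^ω⟮𝓘(ℂ, Fin n → ℂ); ℂ, L⟯

/-- The function `ĥ` that represents a fibre metric in a chart `φ` of `M` and in the local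
holomorphic frame of `L` that belongs to the local trivialization `e`. -/
def localMetric (h : ∀ x, L x →ₗ⋆[ℂ] L x →ₗ[ℂ] ℂ) (φ : OpenPartialHomeomorph M (Fin n → ℂ))
    (e : Trivialization ℂ (π ℂ L)) (z : Fin n → ℂ) : ℝ :=
  (h (φ.symm z) (e.symm (φ.symm z) 1) (e.symm (φ.symm z) 1)).re

variable (n) in
/-- A smooth hermitian metric on `L`, conjugate linear in the first argument. -/
structure IsHermitianMetric (h : ∀ x, L x →ₗ⋆[ℂ] L x →ₗ[ℂ] ℂ) : Prop where
  conj_symm : ∀ (x : M) (p q : L x), starRingEnd ℂ (h x p q) = h x q p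
  pos : ∀ (x : M) (q : L x), q ≠ 0 → 0 < (h x q q).re
  smooth : ∀ φ ∈ atlas (Fin n → ℂ) M,
    ∀ (e : Trivialization ℂ (π ℂ L)) [MemTrivializationAtlas e],
      ContDiffOn ℝ ∞ (localMetric h φ e) (φ.target ∩ φ.symm ⁻¹' e.baseSet)

/-- The `(1,0)`-form `∂f` of a function `f` on `ℂⁿ`: the complex linear part of its real
derivative. -/
def partialForm (f : (Fin n → ℂ) → ℂ) (z : Fin n → ℂ) (u : Fin n → ℂ) : ℂ :=
  (1 / 2 : ℂ) * (fderiv ℝ f z u - Complex.I * fderiv ℝ f z (Complex.I • u))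

/-- The curvature of the connection `∇ = d + ∂ log ĥ` (the one compatible with the metric and the
complex structure), i.e. the two-form `d (∂ log ĥ)`, evaluated on the constant vector fields
`u`, `v` of the chart `φ`. -/
def localCurvature (h : ∀ x, L x →ₗ⋆[ℂ] L x →ₗ[ℂ] ℂ) (φ : OpenPartialHomeomorph M (Fin n → ℂ))
    (e : Trivialization ℂ (π ℂ L)) (z u v : Fin n → ℂ) : ℂ :=
  fderiv ℝ (fun w => partialForm (fun y => (Real.log (localMetric h φ e y) : ℂ)) w v) z u
    - fderiv ℝ (fun w => partialForm (fun y => (Real.log (localMetric h φ e y) : ℂ)) w u) z v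

/-- The prequantum condition `F = -i κ`. -/
def QuantumCondition (κ : TwoForm n M) (h : ∀ x, L x →ₗ⋆[ℂ] L x →ₗ[ℂ] ℂ) : Prop :=
  ∀ φ ∈ atlas (Fin n → ℂ) M, ∀ (e : Trivialization ℂ (π ℂ L)) [MemTrivializationAtlas e],
    ∀ z ∈ φ.target, φ.symm z ∈ e.baseSet → ∀ u v : Fin n → ℂ,
      localCurvature h φ e z u v = -Complex.I * (localForm κ φ z ![u, v] : ℂ)

/-- The scalar product of two global holomorphic sections: the integral of `h(s, t)` against the
volume form `κ ∧ ⋯ ∧ κ / n!`. -/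
def sectionInner [MeasurableSpace M] (κ : TwoForm n M) (h : ∀ x, L x →ₗ⋆[ℂ] L x →ₗ[ℂ] ℂ)
    (s t : HolSection n L) : ℂ :=
  ∫ x, h x (s x) (t x) ∂(liouvilleMeasure κ)

/-! ### Coherent vectors and cyclic `m`-point functions -/

/-- Any vector of a line is a multiple of a given non-zero vector. -/
theorem exists_smul_eq {x : M} {q : L x} (hq : q ≠ 0) (p : L x) : ∃ c : ℂ, p = c • q := by
  let ψ : L x ≃L[ℂ] ℂ :=
    (trivializationAt ℂ L x).continuousLinearEquivAt ℂ x (mem_baseSet_trivializationAt ℂ L x)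
  have h0 : ψ q ≠ 0 := by simpa using hq
  refine ⟨ψ p / ψ q, ψ.injective ?_⟩
  simp [h0]

/-- The linear form `q̂` on global sections: `s(x) = q̂(s) q` for `0 ≠ q` in the fibre over `x`
(and `0` for `q = 0`). -/
def qhat {x : M} (q : L x) (s : HolSection n L) : ℂ := by
  classical
  exact if hq : q ≠ 0 then (exists_smul_eq hq (s x)).choose else 0

theorem qhat_spec {x : M} {q : L x} (hq : q ≠ 0) (s : HolSection n L) : s x = qhat q s • q := by
  rw [qhat, dif_pos hq]
  exact (exists_smul_eq hq (s x)).choose_spec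

/-- `e` is the section that represents the linear form `q̂`: `⟨e, s⟩ = q̂(s)` for all global
holomorphic sections `s`. -/
def IsCoherentVector [MeasurableSpace M] (κ : TwoForm n M) (h : ∀ x, L x →ₗ⋆[ℂ] L x →ₗ[ℂ] ℂ)
    {x : M} (q : L x) (e : HolSection n L) : Prop :=
  ∀ s : HolSection n L, sectionInner κ h e s = qhat q s

/-- The coherent vector `e_q`, the unique section representing `q̂`. -/
def coherentVector [MeasurableSpace M] (κ : TwoForm n M) (h : ∀ x, L x →ₗ⋆[ℂ] L x →ₗ[ℂ] ℂ)
    {x : M} (q : L x) : HolSection n L :=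
  Classical.epsilon (IsCoherentVector κ h q)

/-- The cyclic product
`⟨e_{q₁}, e_{q₂}⟩ ⟨e_{q₂}, e_{q₃}⟩ ⋯ ⟨e_{q_m}, e_{q₁}⟩ / (‖e_{q₁}‖² ⋯ ‖e_{q_m}‖²)` for elements
`q_k` of the fibres over `x_k`. -/
def mPointLift [MeasurableSpace M] (κ : TwoForm n M) (h : ∀ x, L x →ₗ⋆[ℂ] L x →ₗ[ℂ] ℂ)
    {m : ℕ} (x : Fin m → M) (q : ∀ k, L (x k)) : ℂ :=
  (∏ k, sectionInner κ h (coherentVector κ h (q k))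
      (coherentVector κ h (q (finRotate m k)))) /
    ∏ k, sectionInner κ h (coherentVector κ h (q k)) (coherentVector κ h (q k))

/-- A non-zero element of the fibre over `x`. -/
def fibreElement (L : M → Type*) [∀ x, AddCommGroup (L x)] [∀ x, Module ℂ (L x)]
    [∀ x, TopologicalSpace (L x)] [TopologicalSpace (TotalSpace ℂ L)] [FiberBundle ℂ L]
    (x : M) : L x :=
  (trivializationAt ℂ L x).symm x 1

theorem fibreElement_ne_zero (x : M) : fibreElement L x ≠ 0 := by
  have hx := mem_baseSet_trivializationAt ℂ L x
  intro h0
  have h1 := (trivializationAt ℂ L x).mk_symm hx 1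
  have h2 := (trivializationAt ℂ L x).apply_mk_symm hx (1 : ℂ)
  rw [show (trivializationAt ℂ L x).symm x 1 = 0 from h0] at h2
  have h3 : ((trivializationAt ℂ L x) ⟨x, 0⟩).2 = 0 :=
    map_zero ((trivializationAt ℂ L x).continuousLinearEquivAt ℂ x hx)
  rw [h2] at h3
  exact one_ne_zero h3

/-- The cyclic `m`-point function `Ψ^(m)` of `M`, computed from some non-zero elements of the
fibres. -/
def mPoint [MeasurableSpace M] (κ : TwoForm n M) (h : ∀ x, L x →ₗ⋆[ℂ] L x →ₗ[ℂ] ℂ)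
    {m : ℕ} (x : Fin m → M) : ℂ :=
  mPointLift κ h x fun k => fibreElement L (x k)

variable (n L) in
/-- The global holomorphic sections of `L` have no common zero. -/
def NoCommonZero : Prop := ∀ x : M, ∃ s : HolSection n L, s x ≠ 0

/-- The tuple `(q̂(s₀), …, q̂(s_N))`. -/
def homCoords {N : ℕ} (s : Module.Basis (Fin (N + 1)) ℂ (HolSection n L)) {x : M} (q : L x) :
    EuclideanSpace ℂ (Fin (N + 1)) :=
  WithLp.toLp 2 fun j => qhat q (s j)

theorem homCoords_ne_zero (h0 : NoCommonZero n L) {N : ℕ}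
    (s : Module.Basis (Fin (N + 1)) ℂ (HolSection n L)) {x : M} {q : L x} (hq : q ≠ 0) :
    homCoords s q ≠ 0 := by
  intro h
  obtain ⟨t, ht⟩ := h0 x
  apply ht
  have hz : ∀ j, s j x = 0 := fun j => by
    have : qhat q (s j) = 0 := congrArg (fun v : EuclideanSpace ℂ (Fin (N + 1)) => v j) h
    rw [qhat_spec hq, this, zero_smul]
  let ev : HolSection n L →ₗ[ℂ] L x :=
    { toFun := fun s => s x, map_add' := fun _ _ => rfl, map_smul' := fun _ _ => rfl }
  have : ev = 0 := s.ext fun j => hz j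
  exact congrArg (fun f : HolSection n L →ₗ[ℂ] L x => f t) this

/-- The map `x ↦ (s₀(x) : … : s_N(x))` to projective space given by a basis of the space of global
holomorphic sections. For an orthonormal basis it is the (holomorphic) coherent state embedding. -/
def projectiveMap (h0 : NoCommonZero n L) {N : ℕ}
    (s : Module.Basis (Fin (N + 1)) ℂ (HolSection n L)) (x : M) :
    ℙ ℂ (EuclideanSpace ℂ (Fin (N + 1))) :=
  Projectivization.mk ℂ (homCoords s (fibreElement L x))
    (homCoords_ne_zero h0 s (fibreElement_ne_zero x))

/-- The point `(s₀(x) : … : s_N(x))` can be computed from any non-zero element of the fibre. -/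
theorem projectiveMap_eq (h0 : NoCommonZero n L) {N : ℕ}
    (s : Module.Basis (Fin (N + 1)) ℂ (HolSection n L)) {x : M} {q : L x} (hq : q ≠ 0) :
    projectiveMap h0 s x = Projectivization.mk ℂ (homCoords s q) (homCoords_ne_zero h0 s hq) := by
  rw [projectiveMap, Projectivization.mk_eq_mk_iff']
  obtain ⟨c, hc⟩ := exists_smul_eq (fibreElement_ne_zero (L := L) x) q
  refine ⟨c, ?_⟩
  ext j
  change c * qhat q (s j) = qhat (fibreElement L x) (s j)
  have h1 := qhat_spec hq (s j)
  rw [qhat_spec (fibreElement_ne_zero (L := L) x) (s j)] at h1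
  have h2 : (qhat (fibreElement L x) (s j) - c * qhat q (s j)) • fibreElement L x = 0 := by
    rw [sub_smul, h1, mul_comm, mul_smul, ← hc, sub_self]
  rcases smul_eq_zero.1 h2 with h3 | h3
  · exact (sub_eq_zero.1 h3).symm
  · exact absurd h3 (fibreElement_ne_zero x)

end LineBundle

/-! ### Projective space as a complex manifold -/

section ProjectiveSpace

/-- Complex projective space of dimension `N`. -/
abbrev PSpace (N : ℕ) : Type := ℙ ℂ (EuclideanSpace ℂ (Fin (N + 1)))

variable {N : ℕ}

instance : TopologicalSpace (PSpace N) :=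
  inferInstanceAs (TopologicalSpace
    (Quotient (projectivizationSetoid ℂ (EuclideanSpace ℂ (Fin (N + 1))))))

instance : MeasurableSpace (PSpace N) := borel _

instance : BorelSpace (PSpace N) := ⟨rfl⟩

/-- The quotient `z_i / z_j` of two homogeneous coordinates. -/
def ratio (i j : Fin (N + 1)) (p : PSpace N) : ℂ := p.rep i / p.rep j

theorem rep_eq (v : EuclideanSpace ℂ (Fin (N + 1))) (hv : v ≠ 0) :
    ∃ a : ℂ, a ≠ 0 ∧ ∀ i, (Projectivization.mk ℂ v hv).rep i = a * v i := by
  obtain ⟨a, ha⟩ := Projectivization.exists_smul_eq_mk_rep ℂ v hv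
  exact ⟨a, a.ne_zero, fun i => by rw [← ha]; rfl⟩

theorem ratio_mk (v : EuclideanSpace ℂ (Fin (N + 1))) (hv : v ≠ 0) (i j : Fin (N + 1)) :
    ratio i j (Projectivization.mk ℂ v hv) = v i / v j := by
  obtain ⟨a, ha, h⟩ := rep_eq v hv
  rw [ratio, h, h, mul_div_mul_left _ _ ha]

/-- The set of points whose homogeneous coordinate `z_i` does not vanish. -/
def affineSet (i : Fin (N + 1)) : Set (PSpace N) := {p | p.rep i ≠ 0}

theorem mk_mem_affineSet (v : EuclideanSpace ℂ (Fin (N + 1))) (hv : v ≠ 0) (i : Fin (N + 1)) :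
    Projectivization.mk ℂ v hv ∈ affineSet i ↔ v i ≠ 0 := by
  obtain ⟨a, ha, h⟩ := rep_eq v hv
  simp [affineSet, h, ha]

theorem isQuotientMap_mk' :
    Topology.IsQuotientMap (Projectivization.mk' ℂ : {v : EuclideanSpace ℂ (Fin (N + 1)) // v ≠ 0} → _) :=
  isQuotientMap_quotient_mk'

theorem continuous_coord (i : Fin (N + 1)) :
    Continuous fun v : {v : EuclideanSpace ℂ (Fin (N + 1)) // v ≠ 0} => v.1 i := by
  fun_prop

theorem isOpen_affineSet (i : Fin (N + 1)) : IsOpen (affineSet (N := N) i) := by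
  rw [← isQuotientMap_mk'.isOpen_preimage]
  have : Projectivization.mk' ℂ ⁻¹' affineSet i
      = {v : {v : EuclideanSpace ℂ (Fin (N + 1)) // v ≠ 0} | v.1 i ≠ 0} := by
    ext v
    exact mk_mem_affineSet v.1 v.2 i
  rw [this]
  exact isOpen_ne_fun (continuous_coord i) continuous_const

theorem continuousOn_ratio (i j : Fin (N + 1)) : ContinuousOn (ratio (N := N) i j) (affineSet j) := by
  rw [isQuotientMap_mk'.continuousOn_isOpen_iff (isOpen_affineSet j)]
  have h1 : ContinuousOn (fun v : {v : EuclideanSpace ℂ (Fin (N + 1)) // v ≠ 0} => v.1 i / v.1 j)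
      (Projectivization.mk' ℂ ⁻¹' affineSet j) :=
    (continuous_coord i).continuousOn.div (continuous_coord j).continuousOn
      fun v hv => (mk_mem_affineSet v.1 v.2 j).1 hv
  exact h1.congr fun v _ => ratio_mk v.1 v.2 i j

/-- The homogeneous coordinates with `z_i = 1` of the point of the `i`-th affine chart with affine
coordinates `w`. -/
def homog (i : Fin (N + 1)) (w : Fin N → ℂ) : EuclideanSpace ℂ (Fin (N + 1)) :=
  WithLp.toLp 2 (i.insertNth 1 w : Fin (N + 1) → ℂ)

@[simp] theorem homog_same (i : Fin (N + 1)) (w : Fin N → ℂ) : homog i w i = 1 := by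
  simp [homog]

@[simp] theorem homog_succAbove (i : Fin (N + 1)) (w : Fin N → ℂ) (j : Fin N) :
    homog i w (i.succAbove j) = w j := by
  simp [homog]

theorem homog_ne_zero (i : Fin (N + 1)) (w : Fin N → ℂ) : homog i w ≠ 0 := fun h => by
  have := homog_same i w
  rw [h] at this
  exact zero_ne_one this

theorem contDiff_homog (i k : Fin (N + 1)) : ContDiff ℂ ω fun w : Fin N → ℂ => homog i w k := by
  rcases Fin.eq_self_or_eq_succAbove i k with rfl | ⟨j, rfl⟩
  · simpa using contDiff_const
  · simpa using contDiff_apply ℂ ℂ j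

/-- The `i`-th affine chart of projective space, with coordinates `z_k / z_i`, `k ≠ i`. -/
def affineChart (i : Fin (N + 1)) : OpenPartialHomeomorph (PSpace N) (Fin N → ℂ) where
  toFun p j := ratio (i.succAbove j) i p
  invFun w := Projectivization.mk ℂ (homog i w) (homog_ne_zero i w)
  source := affineSet i
  target := univ
  map_source' _ _ := mem_univ _
  map_target' w _ := by simp [mk_mem_affineSet]
  left_inv' p hp := by
    induction p using Projectivization.ind with
    | h v hv =>
      have hi : v i ≠ 0 := (mk_mem_affineSet v hv i).1 hp
      rw [Projectivization.mk_eq_mk_iff']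
      refine ⟨(v i)⁻¹, ?_⟩
      ext k
      rcases Fin.eq_self_or_eq_succAbove i k with rfl | ⟨j, rfl⟩
      · simp [hi]
      · simp [ratio_mk, div_eq_inv_mul]
  right_inv' w _ := by
    funext j
    simp [ratio_mk]
  open_source := isOpen_affineSet i
  open_target := isOpen_univ
  continuousOn_toFun := continuousOn_pi.2 fun j => continuousOn_ratio _ _
  continuousOn_invFun := by
    have h1 : Continuous (homog i) := by
      refine (PiLp.continuous_toLp 2 _).comp (continuous_pi fun k => ?_)
      exact (contDiff_homog i k).continuous
    exact (isQuotientMap_mk'.continuous.comp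
      (h1.subtype_mk (homog_ne_zero i))).continuousOn

theorem exists_rep_ne_zero (p : PSpace N) : ∃ i, p.rep i ≠ 0 := by
  by_contra! h
  exact p.rep_nonzero (by ext i; exact h i)

/-- The index of an affine chart that contains the point `p`. -/
def indexAt (p : PSpace N) : Fin (N + 1) := (exists_rep_ne_zero p).choose

theorem mem_affineSet_indexAt (p : PSpace N) : p ∈ affineSet (indexAt p) :=
  (exists_rep_ne_zero p).choose_spec

instance : ChartedSpace (Fin N → ℂ) (PSpace N) where
  atlas := range affineChart
  chartAt p := affineChart (indexAt p)
  mem_chart_source p := mem_affineSet_indexAt p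
  chart_mem_atlas _ := mem_range_self _

instance : IsManifold 𝓘(ℂ, Fin N → ℂ) ω (PSpace N) := by
  refine isManifold_of_contDiffOn _ _ _ ?_
  rintro _ _ ⟨i, rfl⟩ ⟨j, rfl⟩
  have h1 : ContDiffOn ℂ ω (fun w : Fin N → ℂ => fun k : Fin N =>
      homog i w (j.succAbove k) / homog i w j) {w | homog i w j ≠ 0} :=
    contDiffOn_pi.2 fun k => (contDiff_homog i _).contDiffOn.div (contDiff_homog i _).contDiffOn
      fun w hw => hw
  refine (h1.congr fun w _ => ?_).mono ?_
  · funext k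
    exact ratio_mk _ _ _ _
  · rintro w ⟨⟨-, hw⟩, -⟩
    exact (mk_mem_affineSet _ _ _).1 hw

/-! ### The hyperplane bundle and the Fubini-Study structure -/

/-- The hyperplane bundle. It is trivial over each affine set `z_i ≠ 0`, and the transition function
from the `i`-th to the `j`-th trivialization is `z_i / z_j`; thus a linear form `ℓ` in the
homogeneous coordinates gives the section with the local representatives `ℓ(z) / z_i`. -/
def hyperplaneCore (N : ℕ) : VectorBundleCore ℂ (PSpace N) ℂ (Fin (N + 1)) where
  baseSet := affineSet
  isOpen_baseSet := isOpen_affineSet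
  indexAt := indexAt
  mem_baseSet_at := mem_affineSet_indexAt
  coordChange i j p := ratio i j p • ContinuousLinearMap.id ℂ ℂ
  coordChange_self i p hp v := by
    have : p.rep i ≠ 0 := hp
    simp [ratio, this]
  continuousOn_coordChange i j :=
    ((continuousOn_ratio i j).mono inter_subset_right).smul continuousOn_const
  coordChange_comp i j k p hp v := by
    have : p.rep j ≠ 0 := hp.1.2
    simp only [ratio, smul_apply, ContinuousLinearMap.id_apply, smul_eq_mul]
    field_simp

theorem contMDiffOn_ratio (i j : Fin (N + 1)) :
    ContMDiffOn 𝓘(ℂ, Fin N → ℂ) 𝓘(ℂ) ω (ratio (N := N) i j) (affineSet i ∩ affineSet j) := by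
  have hc : ContMDiffOn 𝓘(ℂ, Fin N → ℂ) 𝓘(ℂ, Fin N → ℂ) ω (affineChart (N := N) i)
      (affineSet i) :=
    contMDiffOn_of_mem_maximalAtlas
      (IsManifold.subset_maximalAtlas (mem_range_self (f := affineChart) i))
  have key : ∀ p ∈ affineSet (N := N) i, ∀ k, homog i (affineChart i p) k = ratio k i p := by
    intro p hp k
    rcases Fin.eq_self_or_eq_succAbove i k with h | ⟨l, rfl⟩
    · subst h
      have : p.rep k ≠ 0 := hp
      simp [ratio, this]
    · exact homog_succAbove i _ l
  have h1 : ContDiffOn ℂ ω (fun w : Fin N → ℂ => (homog i w j)⁻¹) {w | homog i w j ≠ 0} :=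
    (contDiff_homog i j).contDiffOn.inv fun w hw => hw
  refine ((h1.contMDiffOn).comp (hc.mono inter_subset_left) ?_).congr ?_
  · intro p hp
    have hi : p.rep i ≠ 0 := hp.1
    have hj : p.rep j ≠ 0 := hp.2
    simp [key p hp.1, ratio, hi, hj]
  · intro p hp
    simp [key p hp.1, ratio]

instance : (hyperplaneCore N).IsContMDiff 𝓘(ℂ, Fin N → ℂ) ω where
  contMDiffOn_coordChange i j := (contMDiffOn_ratio i j).smul contMDiffOn_const

/-- The fibres of the hyperplane bundle. -/
abbrev Hyperplane (N : ℕ) : PSpace N → Type := (hyperplaneCore N).Fiber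

/-- The metric of the hyperplane bundle: in the trivialization over the affine chart around `p` with
affine coordinates `w` it is `conj a * b / (1 + ‖w‖²)`. -/
def hyperplaneMetric (N : ℕ) (p : PSpace N) :
    Hyperplane N p →ₗ⋆[ℂ] Hyperplane N p →ₗ[ℂ] ℂ :=
  (((1 + ∑ k, ‖chartAt (Fin N → ℂ) p p k‖ ^ 2)⁻¹ : ℝ) : ℂ) •
    (show ℂ →ₗ⋆[ℂ] ℂ →ₗ[ℂ] ℂ from
      (LinearMap.mul ℂ ℂ).comp (starLinearEquiv ℂ (A := ℂ)).toLinearMap)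

/-- The hermitian matrix
`((1 + ‖w‖²) ∑ᵢ uᵢ v̄ᵢ - (∑ᵢ w̄ᵢ uᵢ) (∑ⱼ wⱼ v̄ⱼ)) / (1 + ‖w‖²)²`
of the Fubini-Study metric in an affine chart, applied to `u` and `v`. -/
def fubiniStudyHermitian (w u v : Fin N → ℂ) : ℂ :=
  ((1 + ∑ i, (‖w i‖ : ℂ) ^ 2) * (∑ i, u i * star (v i))
    - (∑ i, star (w i) * u i) * (∑ j, w j * star (v j))) / (1 + ∑ i, (‖w i‖ : ℂ) ^ 2) ^ 2

theorem fubiniStudyHermitian_add_left (w u u' v : Fin N → ℂ) : fubiniStudyHermitian w (u + u') v =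
    fubiniStudyHermitian w u v + fubiniStudyHermitian w u' v := by
  simp only [fubiniStudyHermitian, Pi.add_apply, add_mul, mul_add, Finset.sum_add_distrib]
  ring

theorem fubiniStudyHermitian_add_right (w u v v' : Fin N → ℂ) :
    fubiniStudyHermitian w u (v + v') =
      fubiniStudyHermitian w u v + fubiniStudyHermitian w u v' := by
  simp only [fubiniStudyHermitian, Pi.add_apply, star_add, mul_add, Finset.sum_add_distrib]
  ring

theorem fubiniStudyHermitian_smul_left (c : ℝ) (w u v : Fin N → ℂ) :
    fubiniStudyHermitian w (c • u) v = c * fubiniStudyHermitian w u v := by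
  have h1 : ∑ i, (c • u) i * star (v i) = c * ∑ i, u i * star (v i) := by
    rw [Finset.mul_sum]
    exact Finset.sum_congr rfl fun i _ => by simp [mul_assoc]
  have h2 : ∑ i, star (w i) * (c • u) i = c * ∑ i, star (w i) * u i := by
    rw [Finset.mul_sum]
    exact Finset.sum_congr rfl fun i _ => by simp [mul_left_comm]
  rw [fubiniStudyHermitian, fubiniStudyHermitian, h1, h2]
  ring

theorem fubiniStudyHermitian_smul_right (c : ℝ) (w u v : Fin N → ℂ) :
    fubiniStudyHermitian w u (c • v) = c * fubiniStudyHermitian w u v := by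
  have h1 : ∀ t : Fin N → ℂ, ∑ i, t i * star ((c • v) i) = c * ∑ i, t i * star (v i) := by
    intro t
    rw [Finset.mul_sum]
    exact Finset.sum_congr rfl fun i _ => by simp [mul_left_comm]
  rw [fubiniStudyHermitian, fubiniStudyHermitian, h1, h1]
  ring

/-- The Fubini-Study form at the point with affine coordinates `w`, as an alternating form on
`ℂᴺ`. Since `dwᵢ ∧ dw̄ⱼ (u, v) = uᵢ v̄ⱼ - vᵢ ūⱼ`, its value at `(u, v)` is
`i (G(u, v) - G(v, u))` for the hermitian form `G` above, which is a real number. -/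
def fubiniStudyAt (w : Fin N → ℂ) : (Fin N → ℂ) [⋀^Fin 2]→L[ℝ] ℝ where
  toFun u := (Complex.I *
    (fubiniStudyHermitian w (u 0) (u 1) - fubiniStudyHermitian w (u 1) (u 0))).re
  map_update_add' {inst} u i a b := by
    rw [Subsingleton.elim inst (instDecidableEqFin 2)]
    rw [← Complex.add_re]
    congr 1
    fin_cases i <;>
      simp [fubiniStudyHermitian_add_left, fubiniStudyHermitian_add_right] <;> ring
  map_update_smul' {inst} u i c a := by
    rw [Subsingleton.elim inst (instDecidableEqFin 2)]
    rw [smul_eq_mul, ← Complex.re_ofReal_mul]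
    congr 1
    fin_cases i <;>
      simp [fubiniStudyHermitian_smul_left, fubiniStudyHermitian_smul_right] <;> ring
  cont := by
    unfold fubiniStudyHermitian
    fun_prop
  map_eq_zero_of_eq' u i j h hij := by
    have h01 : u 0 = u 1 := by
      fin_cases i <;> fin_cases j <;> simp_all
    simp [h01]

/-- The Fubini-Study form of projective space. The tangent space at `p` is identified with `ℂᴺ` by
the affine chart around `p`. -/
def fubiniStudy (N : ℕ) : TwoForm N (PSpace N) := fun p =>
  fubiniStudyAt (chartAt (Fin N → ℂ) p p)

end ProjectiveSpace

/-- `L` is very ample: the global holomorphic sections have no common zero, and the map to projective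
space given by any basis of the space of global holomorphic sections is a holomorphic embedding. -/
def IsVeryAmple (n : ℕ) {M : Type*} [TopologicalSpace M] [ChartedSpace (Fin n → ℂ) M]
    (L : M → Type*) [∀ x, AddCommGroup (L x)] [∀ x, Module ℂ (L x)]
    [∀ x, TopologicalSpace (L x)] [TopologicalSpace (TotalSpace ℂ L)] [FiberBundle ℂ L]
    [VectorBundle ℂ ℂ L] : Prop :=
  ∃ h0 : NoCommonZero n L, ∀ (N : ℕ) (s : Module.Basis (Fin (N + 1)) ℂ (HolSection n L)),
    IsSmoothEmbedding 𝓘(ℂ, Fin n → ℂ) 𝓘(ℂ, Fin N → ℂ) ω (projectiveMap h0 s)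

theorem IsVeryAmple.noCommonZero {n : ℕ} {M : Type*} [TopologicalSpace M]
    [ChartedSpace (Fin n → ℂ) M] {L : M → Type*} [∀ x, AddCommGroup (L x)] [∀ x, Module ℂ (L x)]
    [∀ x, TopologicalSpace (L x)] [TopologicalSpace (TotalSpace ℂ L)] [FiberBundle ℂ L]
    [VectorBundle ℂ ℂ L] (h : IsVeryAmple n L) : NoCommonZero n L :=
  h.choose

end CoherentState

end

/-! In an orthonormal basis the coherent vector is `e_q = ∑ conj(q̂(s_j)) s_j`, so `⟨e_p, e_q⟩` is
the standard product `⟨Z(q), Z(p)⟩` of the tuples `Z(q) = (q̂(s_0), …, q̂(s_N))`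
(`sectionInner_coherentVector`). These tuples are homogeneous coordinates of the points of the
coherent state embedding. In a cyclic product each vector stands once in the conjugate linear slot
and once in the linear slot, so rescaling it by `a` multiplies numerator and denominator by the same
`|a|²` (`cyclicProduct_smul`). This gives the formula in arbitrary homogeneous coordinates and the
independence of the `q`, for any line bundle whose space of sections has an orthonormal basis and no
common zero (`mPointLift_eq_of_mk_eq`).

For the comparison with projective space the same formula is applied to the hyperplane bundle. It
remains to see that the coherent state map of projective space is the identity
(`projectiveMap_hyperplaneBasis`), that is, that the homogeneous coordinates, all scaled by one
constant, form an orthonormal basis of the sections. They span because a section is, in an affine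
chart, an entire function of linear growth, hence affine by Liouville's theorem. They are orthogonal
because the Fubini-Study volume is invariant under `w ↦ -w`. They have equal norms because the
volume has the same expression in every affine chart, which rests on the Fubini-Study form being
compatible with the changes of charts.

Cyclic invariance is a reindexing of the two products. -/

noncomputable section

namespace CoherentState

/-! ### Coherent vectors in an orthonormal basis and the cyclic product -/

section CoherentVectors

variable {n : ℕ} {M : Type*} [TopologicalSpace M] [ChartedSpace (Fin n → ℂ) M]
  {L : M → Type*} [∀ x, AddCommGroup (L x)] [∀ x, Module ℂ (L x)] [∀ x, TopologicalSpace (L x)]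
  [TopologicalSpace (TotalSpace ℂ L)] [FiberBundle ℂ L] [VectorBundle ℂ ℂ L]

theorem qhat_eq {x : M} {q : L x} (hq : q ≠ 0) {s : HolSection n L} {c : ℂ} (hc : s x = c • q) :
    qhat q s = c := by
  have h1 : (qhat q s - c) • q = 0 := by rw [sub_smul, ← qhat_spec hq, hc, sub_self]
  exact sub_eq_zero.1 ((smul_eq_zero.1 h1).resolve_right hq)

/-- The form `q̂` as a linear map. -/
def qhatLinear {x : M} (q : L x) : HolSection n L →ₗ[ℂ] ℂ where
  toFun := qhat q
  map_add' s t := by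
    by_cases hq : q = 0
    · simp [qhat, hq]
    · exact qhat_eq hq (by
        rw [ContMDiffSection.coe_add, Pi.add_apply, add_smul, ← qhat_spec hq, ← qhat_spec hq])
  map_smul' c s := by
    by_cases hq : q = 0
    · simp [qhat, hq]
    · exact qhat_eq hq (by
        rw [ContMDiffSection.coe_smul, Pi.smul_apply, RingHom.id_apply, smul_eq_mul, mul_smul,
          ← qhat_spec hq])

theorem qhatLinear_apply {x : M} (q : L x) (s : HolSection n L) : qhatLinear q s = qhat q s := rfl

variable [MeasurableSpace M] {κ : TwoForm n M} {h : ∀ x, L x →ₗ⋆[ℂ] L x →ₗ[ℂ] ℂ}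

/-- The scalar product of sections as a sesquilinear form, when all products `h(s, t)` are
integrable. -/
def sectionForm (hint : ∀ s t : HolSection n L,
    Integrable (fun x => h x (s x) (t x)) (liouvilleMeasure κ)) :
    HolSection n L →ₗ⋆[ℂ] HolSection n L →ₗ[ℂ] ℂ :=
  LinearMap.mk₂'ₛₗ (starRingEnd ℂ) (RingHom.id ℂ) (sectionInner κ h)
    (fun s s' t => by
      simp only [sectionInner, ContMDiffSection.coe_add, Pi.add_apply, map_add,
        LinearMap.add_apply]
      exact integral_add (hint s t) (hint s' t))
    (fun c s t => by
      simp only [sectionInner, ContMDiffSection.coe_smul, Pi.smul_apply, LinearMap.map_smulₛₗ,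
        LinearMap.smul_apply]
      exact integral_smul _ _)
    (fun s t t' => by
      simp only [sectionInner, ContMDiffSection.coe_add, Pi.add_apply, map_add]
      exact integral_add (hint s t) (hint s t'))
    (fun c s t => by
      simp only [sectionInner, ContMDiffSection.coe_smul, Pi.smul_apply, LinearMap.map_smul,
        RingHom.id_apply]
      exact integral_smul _ _)

variable {N : ℕ} {s : Module.Basis (Fin (N + 1)) ℂ (HolSection n L)}
  (hint : ∀ s t : HolSection n L, Integrable (fun x => h x (s x) (t x)) (liouvilleMeasure κ))
  (hs : ∀ i j, sectionInner κ h (s i) (s j) = if i = j then 1 else 0)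

include hint hs

theorem sectionInner_basis_left (j : Fin (N + 1)) (t : HolSection n L) :
    sectionInner κ h (s j) t = s.repr t j := by
  change sectionForm hint (s j) t = _
  have hs' : ∀ i j, sectionForm hint (s i) (s j) = if i = j then 1 else 0 := hs
  conv_lhs => rw [← s.sum_repr t]
  simp [hs', -Module.Basis.sum_repr]

theorem sectionInner_basis_right (t : HolSection n L) (j : Fin (N + 1)) :
    sectionInner κ h t (s j) = starRingEnd ℂ (s.repr t j) := by
  change sectionForm hint t (s j) = _
  have hs' : ∀ i j, sectionForm hint (s i) (s j) = if i = j then 1 else 0 := hs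
  conv_lhs => rw [← s.sum_repr t]
  simp [hs', -Module.Basis.sum_repr]

/-- Expanding `t` in the basis turns both sides into `∑ q̂(s_j) t_j`; the coefficients are
conjugated because the scalar product is conjugate linear in its first argument. -/
theorem isCoherentVector_sum {x : M} (q : L x) :
    IsCoherentVector κ h q (∑ j, starRingEnd ℂ (qhat q (s j)) • s j) := by
  intro t
  change sectionForm hint _ t = _
  rw [map_sum, LinearMap.sum_apply, ← qhatLinear_apply]
  conv_rhs => rw [← s.sum_repr t, map_sum]
  refine Finset.sum_congr rfl fun j _ => ?_
  rw [LinearMap.map_smulₛₗ, LinearMap.smul_apply, Complex.conj_conj,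
    show sectionForm hint (s j) t = _ from sectionInner_basis_left hint hs j t, map_smul,
    qhatLinear_apply, smul_eq_mul, smul_eq_mul, mul_comm]

/-- The products with the `s_j` are prescribed, and they are the conjugates of the coordinates.
Uniqueness identifies the section picked by `Classical.epsilon` with the explicit sum. -/
theorem IsCoherentVector.eq {x : M} {q : L x} {e e' : HolSection n L}
    (he : IsCoherentVector κ h q e) (he' : IsCoherentVector κ h q e') : e = e' := by
  refine s.ext_elem fun j => (starRingEnd ℂ).injective ?_
  rw [← sectionInner_basis_right hint hs, ← sectionInner_basis_right hint hs, he, he']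

theorem coherentVector_eq_sum {x : M} (q : L x) :
    coherentVector κ h q = ∑ j, starRingEnd ℂ (qhat q (s j)) • s j :=
  IsCoherentVector.eq hint hs (Classical.epsilon_spec ⟨_, isCoherentVector_sum hint hs q⟩)
    (isCoherentVector_sum hint hs q)

/-- The scalar product of two coherent vectors, in homogeneous coordinates. -/
theorem sectionInner_coherentVector {x y : M} (p : L x) (q : L y) :
    sectionInner κ h (coherentVector κ h p) (coherentVector κ h q)
      = inner ℂ (homCoords s q) (homCoords s p) := by
  have hp : IsCoherentVector κ h p (coherentVector κ h p) :=
    Classical.epsilon_spec ⟨_, isCoherentVector_sum hint hs p⟩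
  -- The product equals `p̂(e_q)`. The conjugated coefficients are those of `e_q`, which is why `q`
  -- ends up in the first slot.
  rw [hp, coherentVector_eq_sum hint hs q, ← qhatLinear_apply, map_sum, PiLp.inner_apply]
  refine Finset.sum_congr rfl fun j _ => ?_
  rw [map_smul, qhatLinear_apply, smul_eq_mul, mul_comm]
  rfl

omit hint hs in
/-- The cyclic product of the scalar products of non-zero vectors depends only on their lines. -/
theorem cyclicProduct_smul {m : ℕ} {E : Type*} [NormedAddCommGroup E] [InnerProductSpace ℂ E]
    (a : Fin m → ℂ) (ha : ∀ k, a k ≠ 0) (v : Fin m → E) :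
    (∏ k, inner ℂ (a (finRotate m k) • v (finRotate m k)) (a k • v k)) /
        ∏ k, ((‖a k • v k‖ ^ 2 : ℝ) : ℂ)
      = (∏ k, inner ℂ (v (finRotate m k)) (v k)) / ∏ k, ((‖v k‖ ^ 2 : ℝ) : ℂ) := by
  have h1 : ∀ k, ((‖a k • v k‖ ^ 2 : ℝ) : ℂ) =
      (starRingEnd ℂ (a k) * a k) * ((‖v k‖ ^ 2 : ℝ) : ℂ) := fun k => by
    rw [norm_smul, mul_pow, Complex.ofReal_mul, ← Complex.normSq_eq_conj_mul_self,
      Complex.normSq_eq_norm_sq]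
  -- The rotation permutes the indices, so every `conj (a k)` occurs exactly once and pairs with `a
  -- k`.
  have h2 : ∏ k, starRingEnd ℂ (a (finRotate m k)) = ∏ k, starRingEnd ℂ (a k) :=
    Equiv.prod_comp (finRotate m) fun k => starRingEnd ℂ (a k)
  have h3 : ∏ k, (starRingEnd ℂ (a k) * a k) ≠ 0 :=
    Finset.prod_ne_zero_iff.2 fun k _ => mul_ne_zero ((map_ne_zero _).2 (ha k)) (ha k)
  have h4 : ∏ k, inner ℂ (a (finRotate m k) • v (finRotate m k)) (a k • v k) =
      (∏ k, (starRingEnd ℂ (a k) * a k)) * ∏ k, inner ℂ (v (finRotate m k)) (v k) := by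
    simp only [inner_smul_left, inner_smul_right, Finset.prod_mul_distrib, h2]
    ring
  have h5 : ∏ k, ((‖a k • v k‖ ^ 2 : ℝ) : ℂ) =
      (∏ k, (starRingEnd ℂ (a k) * a k)) * ∏ k, ((‖v k‖ ^ 2 : ℝ) : ℂ) := by
    rw [← Finset.prod_mul_distrib]
    exact Finset.prod_congr rfl fun k _ => h1 k
  rw [h4, h5, mul_div_mul_left _ _ h3]

theorem mPointLift_eq {m : ℕ} (x : Fin m → M) (q : ∀ k, L (x k)) :
    mPointLift κ h x q = (∏ k, inner ℂ (homCoords s (q (finRotate m k))) (homCoords s (q k))) /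
      ∏ k, ((‖homCoords s (q k)‖ ^ 2 : ℝ) : ℂ) := by
  rw [mPointLift]
  congr 1
  · exact Finset.prod_congr rfl fun k _ => sectionInner_coherentVector hint hs _ _
  · refine Finset.prod_congr rfl fun k _ => ?_
    rw [sectionInner_coherentVector hint hs, inner_self_eq_norm_sq_to_K, Complex.ofReal_pow]
    rfl

/-- The cyclic `m`-point function in arbitrary homogeneous coordinates of the points
`(s₀(x) : … : s_N(x))`, for an orthonormal basis of the space of sections. -/
theorem mPointLift_eq_of_mk_eq (h0 : NoCommonZero n L) {m : ℕ} (x : Fin m → M)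
    (q : ∀ k, L (x k)) (hq : ∀ k, q k ≠ 0) (z : Fin m → EuclideanSpace ℂ (Fin (N + 1)))
    (hz : ∀ k, z k ≠ 0) (hzx : ∀ k, Projectivization.mk ℂ (z k) (hz k) = projectiveMap h0 s (x k)) :
    mPointLift κ h x q =
      (∏ k, inner ℂ (z (finRotate m k)) (z k)) / ∏ k, ((‖z k‖ ^ 2 : ℝ) : ℂ) := by
  have h1 : ∀ k, ∃ a : ℂ, a • homCoords s (q k) = z k := fun k => by
    have := hzx k
    rwa [projectiveMap_eq h0 s (hq k), Projectivization.mk_eq_mk_iff'] at this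
  choose a ha using h1
  have ha0 : ∀ k, a k ≠ 0 := fun k hk => hz k (by rw [← ha, hk, zero_smul])
  simp only [← ha]
  rw [cyclicProduct_smul a ha0 fun k => homCoords s (q k), mPointLift_eq hint hs]

end CoherentVectors

/-! ### Integrability of the products of sections -/

section Integrability

variable {n : ℕ} {M : Type*} [TopologicalSpace M] [ChartedSpace (Fin n → ℂ) M]
  {L : M → Type*} [∀ x, AddCommGroup (L x)] [∀ x, Module ℂ (L x)] [∀ x, TopologicalSpace (L x)]
  [TopologicalSpace (TotalSpace ℂ L)] [FiberBundle ℂ L] [VectorBundle ℂ ℂ L]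
  {h : ∀ x, L x →ₗ⋆[ℂ] L x →ₗ[ℂ] ℂ}

theorem eq_smul_symm (e : Trivialization ℂ (π ℂ L)) [MemTrivializationAtlas e] {x : M}
    (hx : x ∈ e.baseSet) (v : L x) : v = (e ⟨x, v⟩).2 • e.symm x 1 := by
  have h1 : e.symm x (e ⟨x, v⟩).2 = v := e.symm_apply_apply_mk hx v
  have h2 := map_smul (e.symmₗ ℂ x) (e ⟨x, v⟩).2 (1 : ℂ)
  rw [smul_eq_mul, mul_one, Trivialization.coe_symmₗ e hx] at h2
  rw [← h2, h1]

theorem metric_eq_localMetric (hh : IsHermitianMetric n h) (φ : OpenPartialHomeomorph M (Fin n → ℂ))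
    (e : Trivialization ℂ (π ℂ L)) [MemTrivializationAtlas e] {x : M}
    (hφ : x ∈ φ.source) (hx : x ∈ e.baseSet) (v w : L x) :
    h x v w = starRingEnd ℂ (e ⟨x, v⟩).2 * (e ⟨x, w⟩).2 * (localMetric h φ e (φ x) : ℂ) := by
  have h1 : ((localMetric h φ e (φ x) : ℝ) : ℂ) = h x (e.symm x 1) (e.symm x 1) := by
    rw [localMetric, φ.left_inv hφ]
    -- Hermitian symmetry makes `h(q, q)` real, so the real part in `localMetric` loses nothing.
    exact Complex.conj_eq_iff_re.1 (hh.conj_symm _ _ _)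
  conv_lhs => rw [eq_smul_symm e hx v, eq_smul_symm e hx w]
  simp only [h1, LinearMap.map_smulₛₗ, LinearMap.smul_apply, map_smul, smul_eq_mul]
  ring

theorem continuous_metric (hh : IsHermitianMetric n h) (s t : HolSection n L) :
    Continuous fun x => h x (s x) (t x) := by
  rw [continuous_iff_continuousAt]
  intro x
  set φ := chartAt (Fin n → ℂ) x
  set e := trivializationAt ℂ L x
  have hφ : x ∈ φ.source := mem_chart_source _ x
  have he : x ∈ e.baseSet := mem_baseSet_trivializationAt ℂ L x
  have hsec : ∀ s : HolSection n L, ContinuousAt (fun y => (e ⟨y, s y⟩).2) x := fun s =>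
    ((contMDiffAt_section x).1 (s.contMDiff x)).continuousAt
  have hmet : ContinuousAt (fun y => localMetric h φ e (φ y)) x := by
    have hopen : IsOpen (φ.target ∩ φ.symm ⁻¹' e.baseSet) :=
      φ.symm.isOpen_inter_preimage e.open_baseSet
    have hmem : φ x ∈ φ.target ∩ φ.symm ⁻¹' e.baseSet :=
      ⟨φ.map_source hφ, by simpa [φ.left_inv hφ] using he⟩
    exact ContinuousAt.comp (f := φ) (g := localMetric h φ e)
      ((hh.smooth φ (chart_mem_atlas _ x) e).continuousOn.continuousAt (hopen.mem_nhds hmem))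
      (φ.continuousAt hφ)
  have hcont : ContinuousAt (fun y => starRingEnd ℂ (e ⟨y, s y⟩).2 * (e ⟨y, t y⟩).2 *
      (localMetric h φ e (φ y) : ℂ)) x :=
    ((Complex.continuous_conj.continuousAt.comp (hsec s)).mul (hsec t)).mul
      (Complex.continuous_ofReal.continuousAt.comp hmet)
  refine hcont.congr ?_
  filter_upwards [φ.open_source.mem_nhds hφ, e.open_baseSet.mem_nhds he] with y hy hy'
  exact (metric_eq_localMetric hh φ e hy hy' _ _).symm

/-- The fibre is a line: with `p = a f` and `q = b f` this is `|a| |b| ≤ |a|² + |b|²`. It dominates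
mixed products by diagonal ones. -/
theorem norm_metric_le {x : M} (p q : L x) :
    ‖h x p q‖ ≤ ‖h x p p‖ + ‖h x q q‖ := by
  obtain ⟨a, rfl⟩ := exists_smul_eq (fibreElement_ne_zero (L := L) x) p
  obtain ⟨b, rfl⟩ := exists_smul_eq (fibreElement_ne_zero (L := L) x) q
  simp only [LinearMap.map_smulₛₗ, LinearMap.smul_apply, map_smul, smul_eq_mul, norm_mul,
    RCLike.norm_conj]
  nlinarith [mul_nonneg (sq_nonneg (‖a‖ - ‖b‖)) (norm_nonneg (h x (fibreElement L x)
    (fibreElement L x))), mul_nonneg (mul_nonneg (norm_nonneg a) (norm_nonneg b))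
    (norm_nonneg (h x (fibreElement L x) (fibreElement L x)))]

/-- If the products `h(sᵢ, sⱼ)` of the elements of a spanning family are integrable, then so are the
products of all sections. -/
theorem integrable_metric_of_span [MeasurableSpace M] {μ : Measure M} {ι : Type*} [Fintype ι]
    {s : ι → HolSection n L} (hspan : ⊤ ≤ Submodule.span ℂ (range s))
    (hs : ∀ i j, Integrable (fun x => h x (s i x) (s j x)) μ) (t t' : HolSection n L) :
    Integrable (fun x => h x (t x) (t' x)) μ := by
  let ev (x : M) : HolSection n L →ₗ[ℂ] L x :=
    { toFun := fun s => s x, map_add' := fun _ _ => rfl, map_smul' := fun _ _ => rfl }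
  have hexp : ∀ t : HolSection n L, ∃ c : ι → ℂ, ∀ x, t x = ∑ i, c i • s i x := fun t => by
    obtain ⟨c, hc⟩ := (Submodule.mem_span_range_iff_exists_fun ℂ).1 (hspan (Submodule.mem_top (x := t)))
    refine ⟨c, fun x => ?_⟩
    have := congrArg (ev x) hc.symm
    rw [map_sum] at this
    exact this
  obtain ⟨c, hc⟩ := hexp t
  obtain ⟨c', hc'⟩ := hexp t'
  have heq : (fun x => h x (t x) (t' x)) = fun x =>
      ∑ j, c' j * ∑ i, starRingEnd ℂ (c i) * h x (s i x) (s j x) := by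
    funext x
    rw [hc, hc']
    simp only [map_sum, LinearMap.sum_apply, LinearMap.map_smulₛₗ, LinearMap.smul_apply,
      smul_eq_mul, RingHom.id_apply]
  rw [heq]
  exact integrable_finsetSum _ fun j _ => (integrable_finsetSum _ fun i _ =>
    (hs i j).const_mul _).const_mul _

/-- If the sections of a basis have non-zero norms, then all the products `h(s, t)` are
integrable. -/
theorem integrable_metric [MeasurableSpace M] [BorelSpace M] {κ : TwoForm n M}
    (hh : IsHermitianMetric n h) {ι : Type*} [Fintype ι]
    (s : Module.Basis ι ℂ (HolSection n L)) (hs : ∀ i, sectionInner κ h (s i) (s i) ≠ 0)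
    (t t' : HolSection n L) :
    Integrable (fun x => h x (t x) (t' x)) (liouvilleMeasure κ) := by
  have hdiag : ∀ i, Integrable (fun x => h x (s i x) (s i x)) (liouvilleMeasure κ) := fun i => by
    by_contra hi
    -- The integral of a non-integrable function is `0` by convention, so a non-zero norm already
    -- forces integrability.
    exact hs i (integral_undef hi)
  exact integrable_metric_of_span s.span_eq.ge (fun i j =>
    ((hdiag i).norm.add (hdiag j).norm).mono'
      (continuous_metric hh _ _).aestronglyMeasurable
      (Filter.Eventually.of_forall fun x => norm_metric_le _ _)) t t'

end Integrability

/-! ### The top power of a two-form as a multiple of the determinant -/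

section TopPower

variable {n : ℕ}

/-- The real frame `e₁, i e₁, e₂, i e₂, …` as a basis of `ℂⁿ`. -/
def realBasis (n : ℕ) : Module.Basis (Fin n × Fin 2) ℝ (Fin n → ℂ) :=
  (Pi.basis fun _ : Fin n => Complex.basisOneI).reindex (Equiv.sigmaEquivProd (Fin n) (Fin 2))

theorem coe_realBasis : ⇑(realBasis n) = realFrame n := by
  funext p
  obtain ⟨k, b⟩ := p
  fin_cases b <;> simp [realBasis, realFrame]

theorem update_pair_zero {E : Type*} (x y z : E) : Function.update ![x, y] 0 z = ![z, y] := by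
  funext b
  fin_cases b <;> rfl

theorem update_pair_one {E : Type*} (x y z : E) : Function.update ![x, y] 1 z = ![x, z] := by
  funext b
  fin_cases b <;> rfl

/-- The multilinear map `v ↦ ∏ₖ α(v₍ₖ,₀₎, v₍ₖ,₁₎)`. -/
def pairingProduct (α : (Fin n → ℂ) [⋀^Fin 2]→L[ℝ] ℝ) :
    MultilinearMap ℝ (fun _ : Fin n × Fin 2 => (Fin n → ℂ)) ℝ where
  toFun v := ∏ k, α ![v (k, 0), v (k, 1)]
  map_update_add' {inst} v p x y := by
    obtain rfl : inst = instDecidableEqProd := Subsingleton.elim _ _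
    obtain ⟨k, b⟩ := p
    -- Only the `k`-th factor contains the slot `(k, b)`, and that factor is linear in it.
    have hne : ∀ z, ∏ l ∈ {k}ᶜ, α ![Function.update v (k, b) z (l, 0),
        Function.update v (k, b) z (l, 1)] = ∏ l ∈ {k}ᶜ, α ![v (l, 0), v (l, 1)] := fun z =>
      Finset.prod_congr rfl fun l hl => by
        have : l ≠ k := by simpa using hl
        simp [this]
    simp only [Fintype.prod_eq_mul_prod_compl k, hne, ← add_mul]
    congr 1
    have h0 := α.map_update_add ![x, v (k, 1)] 0 x y
    have h1 := α.map_update_add ![v (k, 0), x] 1 x y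
    simp only [update_pair_zero, update_pair_one] at h0 h1
    fin_cases b
    · simpa using h0
    · simpa using h1
  map_update_smul' {inst} v p c x := by
    obtain rfl : inst = instDecidableEqProd := Subsingleton.elim _ _
    obtain ⟨k, b⟩ := p
    have hne : ∀ z, ∏ l ∈ {k}ᶜ, α ![Function.update v (k, b) z (l, 0),
        Function.update v (k, b) z (l, 1)] = ∏ l ∈ {k}ᶜ, α ![v (l, 0), v (l, 1)] := fun z =>
      Finset.prod_congr rfl fun l hl => by
        have : l ≠ k := by simpa using hl
        simp [this]
    simp only [Fintype.prod_eq_mul_prod_compl k, hne, smul_eq_mul, ← mul_assoc]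
    congr 1
    have h0 := α.map_update_smul ![x, v (k, 1)] 0 c x
    have h1 := α.map_update_smul ![v (k, 0), x] 1 c x
    simp only [update_pair_zero, update_pair_one, smul_eq_mul] at h0 h1
    fin_cases b
    · simpa using h0
    · simpa using h1

/-- The signed sum over permutations is an alternatization, hence an alternating form of top degree
on the `2n`-dimensional real space, and a linear map acts on such a form through its determinant. -/
theorem topPower_eq_alternatization (α : (Fin n → ℂ) [⋀^Fin 2]→L[ℝ] ℝ)
    (A : (Fin n → ℂ) →L[ℝ] (Fin n → ℂ)) :
    topPower (α.compContinuousLinearMap A) = (1 / ((n.factorial : ℝ) * 2 ^ n)) *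
      MultilinearMap.alternatization (pairingProduct α) (A ∘ realBasis n) := by
  rw [topPower, MultilinearMap.alternatization_apply]
  congr 1
  refine Finset.sum_congr rfl fun σ _ => ?_
  rw [MultilinearMap.domDomCongr_apply, Units.smul_def, zsmul_eq_mul]
  congr 1
  refine Finset.prod_congr rfl fun k _ => ?_
  rw [coe_realBasis, ContinuousAlternatingMap.compContinuousLinearMap_apply]
  congr 1
  funext b
  fin_cases b <;> rfl

/-- The top power of a two-form transforms with the real determinant. -/
theorem topPower_compContinuousLinearMap (α : (Fin n → ℂ) [⋀^Fin 2]→L[ℝ] ℝ)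
    (A : (Fin n → ℂ) →L[ℝ] (Fin n → ℂ)) :
    topPower (α.compContinuousLinearMap A) = A.det * topPower α := by
  have h1 := topPower_eq_alternatization α A
  have h2 := topPower_eq_alternatization α (ContinuousLinearMap.id ℝ _)
  rw [AlternatingMap.eq_smul_basis_det (realBasis n)
    (MultilinearMap.alternatization (pairingProduct α))] at h1 h2
  have h3 : α.compContinuousLinearMap (ContinuousLinearMap.id ℝ _) = α := by ext; rfl
  have h4 : (⇑A ∘ realBasis n) = (A : (Fin n → ℂ) →ₗ[ℝ] (Fin n → ℂ)) ∘ realBasis n := rfl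
  rw [h3] at h2
  rw [h1, h2, h4, AlternatingMap.smul_apply, AlternatingMap.smul_apply, Module.Basis.det_comp]
  simp only [ContinuousLinearMap.coe_id', Function.id_comp, Module.Basis.det_self, smul_eq_mul,
    ContinuousLinearMap.det]
  ring

/-- A form that has the constant value `c` on the pairs `e_k, i e_k` and vanishes on the other pairs
of vectors of the real frame has a top power of at least `c ^ n / (n! 2 ^ n)`. -/
theorem le_topPower (α : (Fin n → ℂ) [⋀^Fin 2]→L[ℝ] ℝ) (c : ℝ)
    (hα : ∀ k, α ![realFrame n (k, 0), realFrame n (k, 1)] = c)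
    (hα' : ∀ p q : Fin n × Fin 2, p.1 ≠ q.1 → α ![realFrame n p, realFrame n q] = 0) (hc : 0 ≤ c) :
    c ^ n / ((n.factorial : ℝ) * 2 ^ n) ≤ topPower α := by
  have hswap : ∀ u v, α ![u, v] = - α ![v, u] := fun u v => by
    have := α.map_swap ![v, u] (i := 0) (j := 1) (by decide)
    refine Eq.trans (congrArg α ?_) this
    funext b
    fin_cases b <;> rfl
  -- A permutation that breaks some pair `{(k, 0), (k, 1)}` has a vanishing factor; one that maps
  -- pairs to pairs contributes `c ^ n`. Keeping only the identity gives the bound.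
  have hterm : ∀ σ : Equiv.Perm (Fin n × Fin 2), 0 ≤ ((Equiv.Perm.sign σ : ℤ) : ℝ) *
      ∏ k : Fin n, α ![realFrame n (σ (k, 0)), realFrame n (σ (k, 1))] := by
    intro σ
    by_cases h : ∀ k, (σ (k, 0)).1 = (σ (k, 1)).1
    · have hfst : ∀ k b, (σ (k, b)).1 = (σ (k, 0)).1 := fun k b => by
        fin_cases b
        · rfl
        · exact (h k).symm
      have hsurj : Function.Surjective fun k => (σ (k, 0)).1 := fun l => by
        obtain ⟨⟨k, b⟩, hk⟩ := σ.surjective (l, 0)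
        exact ⟨k, (hfst k b).symm.trans (congrArg Prod.fst hk)⟩
      let τ : Equiv.Perm (Fin n) := Equiv.ofBijective _ (Finite.injective_iff_bijective.1
        (Finite.injective_iff_surjective.2 hsurj))
      have hinj : ∀ k, Function.Injective fun b => (σ (k, b)).2 := fun k b b' hb => by
        have : σ (k, b) = σ (k, b') := Prod.ext (by rw [hfst k b, hfst k b']) hb
        exact congrArg Prod.snd (σ.injective this)
      let c' (k : Fin n) : Equiv.Perm (Fin 2) :=
        Equiv.ofBijective _ (Finite.injective_iff_bijective.1 (hinj k))
      -- Flips `c'` inside the pairs, followed by a permutation `τ` of the pairs. The latter acts as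
      -- two copies of `τ` and so is even; each flip changes the sign of one factor, which cancels
      -- its own sign.
      have hσ : σ = Equiv.prodCongrLeft (fun _ : Fin 2 => τ) * Equiv.prodCongrRight c' := by
        ext1 ⟨k, b⟩
        exact Prod.ext (hfst k b) rfl
      have hsign : Equiv.Perm.sign σ = ∏ k, Equiv.Perm.sign (c' k) := by
        rw [hσ, Equiv.Perm.sign_mul, Equiv.Perm.sign_prodCongrLeft, Equiv.Perm.sign_prodCongrRight,
          Finset.prod_const, Finset.card_univ, Fintype.card_fin, Int.units_sq, one_mul]
      have hpair : ∀ k, ((Equiv.Perm.sign (c' k) : ℤ) : ℝ) *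
          α ![realFrame n (σ (k, 0)), realFrame n (σ (k, 1))] = c := fun k => by
        have e0 : σ (k, 0) = (τ k, c' k 0) := rfl
        have e1 : σ (k, 1) = (τ k, c' k 1) := Prod.ext (h k).symm rfl
        rw [e0, e1]
        have : c' k = 1 ∨ c' k = Equiv.swap 0 1 := by
          generalize c' k = d
          revert d
          decide
        rcases this with h | h
        · simp [h, hα]
        · rw [hswap]
          simp [h, hα]
      rw [hsign, Units.coe_prod, Int.cast_prod, ← Finset.prod_mul_distrib]
      exact Finset.prod_nonneg fun k _ => by rw [hpair]; exact hc
    · push Not at h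
      obtain ⟨k, hk⟩ := h
      rw [Finset.prod_eq_zero (Finset.mem_univ k) (hα' _ _ hk), mul_zero]
  have hone : c ^ n = ((Equiv.Perm.sign (1 : Equiv.Perm (Fin n × Fin 2)) : ℤ) : ℝ) *
      ∏ k : Fin n, α ![realFrame n ((1 : Equiv.Perm (Fin n × Fin 2)) (k, 0)),
        realFrame n ((1 : Equiv.Perm (Fin n × Fin 2)) (k, 1))] := by
    simp [hα]
  rw [topPower, div_eq_mul_one_div, mul_comm]
  refine mul_le_mul_of_nonneg_left ?_ (by positivity)
  rw [hone]
  exact Finset.single_le_sum (fun σ _ => hterm σ) (Finset.mem_univ 1)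

end TopPower

/-! ### The Fubini-Study form and its density under changes of charts -/

section FubiniStudy

variable {N : ℕ}

/-- The Fubini-Study hermitian form in homogeneous coordinates: `U`, `V` represent tangent vectors at
the line of `Z`. -/
def projHermitian (Z U V : Fin (N + 1) → ℂ) : ℂ :=
  ((∑ i, Z i * star (Z i)) * (∑ i, U i * star (V i))
    - (∑ i, star (Z i) * U i) * (∑ i, Z i * star (V i))) / (∑ i, Z i * star (Z i)) ^ 2

/-- The coordinate normalized to `1` adds `1` to `‖Z‖²`; being constant, it adds `0` to the tangent
vectors. -/
theorem fubiniStudyHermitian_eq (i : Fin (N + 1)) (w u v : Fin N → ℂ) :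
    fubiniStudyHermitian w u v =
      projHermitian (homog i w) (i.insertNth 0 u : Fin (N + 1) → ℂ)
        (i.insertNth 0 v : Fin (N + 1) → ℂ) := by
  have h1 : ∀ z : ℂ, (‖z‖ : ℂ) ^ 2 = z * star z := fun z => (Complex.mul_conj' z).symm
  simp [fubiniStudyHermitian, projHermitian, Fin.sum_univ_succAbove _ i, h1]

/-- Multiples of `Z` are annihilated in either argument and the expression is homogeneous of degree
zero, so the form descends to the tangent spaces of projective space. This is the source of all
chart independence below. -/
theorem projHermitian_smul_add (Z U V : Fin (N + 1) → ℂ) (hZ : Z ≠ 0) (a b c : ℂ) (ha : a ≠ 0) :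
    projHermitian (a • Z) (a • U + b • Z) (a • V + c • Z) = projHermitian Z U V := by
  have hS : ∑ i, Z i * star (Z i) ≠ 0 := by
    have : ∑ i, Z i * star (Z i) = ((∑ i, ‖Z i‖ ^ 2 : ℝ) : ℂ) := by
      rw [Complex.ofReal_sum]
      exact Finset.sum_congr rfl fun i _ => by
        rw [Complex.ofReal_pow]; exact Complex.mul_conj' (Z i)
    rw [this, Complex.ofReal_ne_zero]
    obtain ⟨i, hi⟩ := Function.ne_iff.1 hZ
    exact (Finset.sum_pos' (fun _ _ => by positivity)
      ⟨i, Finset.mem_univ i, by have : 0 < ‖Z i‖ := norm_pos_iff.2 hi; positivity⟩).ne'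
  have h1 : ∑ i, (a • Z) i * star ((a • Z) i) = a * star a * ∑ i, Z i * star (Z i) := by
    rw [Finset.mul_sum]
    exact Finset.sum_congr rfl fun i _ => by simp; ring
  have h2 : ∑ i, (a • U + b • Z) i * star ((a • V + c • Z) i) =
      a * star a * (∑ i, U i * star (V i)) + a * star c * (∑ i, star (Z i) * U i)
        + b * star a * (∑ i, Z i * star (V i)) + b * star c * ∑ i, Z i * star (Z i) := by
    simp only [Finset.mul_sum, ← Finset.sum_add_distrib]
    exact Finset.sum_congr rfl fun i _ => by simp; ring
  have h3 : ∑ i, star ((a • Z) i) * (a • U + b • Z) i =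
      star a * a * (∑ i, star (Z i) * U i) + star a * b * ∑ i, Z i * star (Z i) := by
    simp only [Finset.mul_sum, ← Finset.sum_add_distrib]
    exact Finset.sum_congr rfl fun i _ => by simp; ring
  have h4 : ∑ i, (a • Z) i * star ((a • V + c • Z) i) =
      a * star a * (∑ i, Z i * star (V i)) + a * star c * ∑ i, Z i * star (Z i) := by
    simp only [Finset.mul_sum, ← Finset.sum_add_distrib]
    exact Finset.sum_congr rfl fun i _ => by simp; ring
  have ha' : star a ≠ 0 := star_ne_zero.2 ha
  rw [projHermitian, projHermitian, h1, h2, h3, h4]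
  field_simp
  ring

/-- The change of coordinates from the `i`-th to the `j`-th affine chart. -/
def transition (i j : Fin (N + 1)) (w : Fin N → ℂ) : Fin N → ℂ :=
  fun k => homog i w (j.succAbove k) / homog i w j

theorem homog_transition {i j : Fin (N + 1)} {w : Fin N → ℂ} (hw : homog i w j ≠ 0) :
    homog j (transition i j w) = (homog i w j)⁻¹ • homog i w := by
  ext k
  rcases Fin.eq_self_or_eq_succAbove j k with rfl | ⟨l, rfl⟩
  · simp [hw]
  · simp [transition, div_eq_inv_mul]

theorem affineChart_symm_apply (i : Fin (N + 1)) (w : Fin N → ℂ) :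
    (affineChart i).symm w = Projectivization.mk ℂ (homog i w) (homog_ne_zero i w) := rfl

theorem affineChart_affineChart_symm (i j : Fin (N + 1)) (w : Fin N → ℂ) :
    affineChart j ((affineChart i).symm w) = transition i j w :=
  funext fun _ => ratio_mk _ _ _ _

theorem affineChart_symm_mem (i j : Fin (N + 1)) (w : Fin N → ℂ) :
    (affineChart i).symm w ∈ affineSet j ↔ homog i w j ≠ 0 :=
  mk_mem_affineSet _ _ _

theorem affineChart_symm_transition {i j : Fin (N + 1)} {w : Fin N → ℂ} (hw : homog i w j ≠ 0) :
    (affineChart j).symm (transition i j w) = (affineChart i).symm w := by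
  rw [← affineChart_affineChart_symm]
  exact (affineChart j).left_inv ((affineChart_symm_mem i j w).2 hw)

theorem exists_hasFDerivAt_homog (i k : Fin (N + 1)) (w : Fin N → ℂ) :
    ∃ ℓ : (Fin N → ℂ) →L[ℝ] ℂ, HasFDerivAt (fun w : Fin N → ℂ => homog i w k) ℓ w ∧
      ∀ u, ℓ u = (i.insertNth 0 u : Fin (N + 1) → ℂ) k := by
  rcases Fin.eq_self_or_eq_succAbove i k with rfl | ⟨j, rfl⟩
  · exact ⟨0, by simpa using hasFDerivAt_const (1 : ℂ) w, fun u => by simp⟩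
  · exact ⟨ContinuousLinearMap.proj j, by simpa using hasFDerivAt_apply j w, fun u => by simp⟩

/-- The quotient rule `d(Z / Z_j) = dZ / Z_j - (dZ_j / Z_j²) Z`, in the shape `a U + b Z` needed for
`projHermitian_smul_add`. -/
theorem exists_hasFDerivAt_transition {i j : Fin (N + 1)} {w : Fin N → ℂ} (hw : homog i w j ≠ 0) :
    ∃ A : (Fin N → ℂ) →L[ℝ] (Fin N → ℂ), HasFDerivAt (transition i j) A w ∧
      ∀ u, (j.insertNth 0 (A u) : Fin (N + 1) → ℂ) =
        (homog i w j)⁻¹ • (i.insertNth 0 u : Fin (N + 1) → ℂ)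
          + (-(i.insertNth 0 u : Fin (N + 1) → ℂ) j / (homog i w j) ^ 2) • ⇑(homog i w) := by
  choose ℓ hℓ hℓ' using fun k => exists_hasFDerivAt_homog i k w
  obtain ⟨B, hB, hB'⟩ : ∃ B : (Fin N → ℂ) →L[ℝ] ℂ, HasFDerivAt (fun w => (homog i w j)⁻¹) B w ∧
      ∀ u, B u = -((homog i w j)⁻¹ * ℓ j u * (homog i w j)⁻¹) :=
    ⟨_, (hasFDerivAt_inv' (𝕜 := ℝ) hw).comp w (hℓ j), fun _ => rfl⟩
  have hd := fun k : Fin N => (hℓ (j.succAbove k)).mul hB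
  refine ⟨_, hasFDerivAt_pi.2 hd, fun u => ?_⟩
  funext k
  rcases Fin.eq_self_or_eq_succAbove j k with rfl | ⟨l, rfl⟩
  · simp only [Fin.insertNth_apply_same, Pi.add_apply, Pi.smul_apply, smul_eq_mul]
    field_simp
    ring
  · simp only [Fin.insertNth_apply_succAbove, Pi.add_apply, Pi.smul_apply, smul_eq_mul,
      ContinuousLinearMap.pi_apply, add_apply, smul_apply, hB', hℓ']
    field_simp
    ring

theorem differentiableAt_transition {i j : Fin (N + 1)} {w : Fin N → ℂ} (hw : homog i w j ≠ 0) :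
    DifferentiableAt ℝ (transition i j) w :=
  let ⟨_, hA, _⟩ := exists_hasFDerivAt_transition hw
  hA.differentiableAt

theorem fubiniStudyAt_apply (w u v : Fin N → ℂ) : fubiniStudyAt w ![u, v] =
    (Complex.I * (fubiniStudyHermitian w u v - fubiniStudyHermitian w v u)).re := rfl

/-- The local expressions of the Fubini-Study form are compatible with the changes of charts. -/
theorem fubiniStudyAt_transition {i j : Fin (N + 1)} {w : Fin N → ℂ} (hw : homog i w j ≠ 0) :
    (fubiniStudyAt (transition i j w)).compContinuousLinearMap (fderiv ℝ (transition i j) w) =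
      fubiniStudyAt w := by
  obtain ⟨A, hA, hA'⟩ := exists_hasFDerivAt_transition hw
  have hZ : ⇑(homog i w) ≠ 0 := fun h => hw (congrFun h j)
  have key : ∀ u v, fubiniStudyHermitian (transition i j w) (A u) (A v) =
      fubiniStudyHermitian w u v := fun u v => by
    rw [fubiniStudyHermitian_eq j, fubiniStudyHermitian_eq i w, hA', hA', homog_transition hw]
    exact projHermitian_smul_add _ _ _ hZ _ _ _ (inv_ne_zero hw)
  rw [hA.fderiv]
  ext u
  change (Complex.I * (fubiniStudyHermitian _ (A (u 0)) (A (u 1)) -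
    fubiniStudyHermitian _ (A (u 1)) (A (u 0)))).re = _
  rw [key, key]
  rfl

/-- The form at a point is defined through the preferred chart there, in which the inverse of the
`i`-th chart becomes a change of charts; compatibility then removes the dependence on the preferred
chart. -/
theorem localForm_fubiniStudy (i : Fin (N + 1)) (w : Fin N → ℂ) :
    localForm (fubiniStudy N) (affineChart i) w = fubiniStudyAt w := by
  set p := (affineChart i).symm w with hp
  have hw : homog i w (indexAt p) ≠ 0 := (affineChart_symm_mem i _ w).1 (mem_affineSet_indexAt p)
  have hm : HasMFDerivAt 𝓘(ℝ, Fin N → ℂ) 𝓘(ℝ, Fin N → ℂ) (affineChart i).symm w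
      (fderiv ℝ (transition i (indexAt p)) w) := by
    refine ⟨(affineChart i).continuousAt_symm (mem_univ w), ?_⟩
    have h1 : writtenInExtChartAt 𝓘(ℝ, Fin N → ℂ) 𝓘(ℝ, Fin N → ℂ) w (affineChart i).symm =
        transition i (indexAt p) := by
      funext v
      exact affineChart_affineChart_symm i (indexAt p) v
    rw [h1]
    exact (differentiableAt_transition hw).hasFDerivAt.hasFDerivWithinAt
  rw [localForm, hm.mfderiv]
  refine Eq.trans ?_ (fubiniStudyAt_transition hw)
  rw [← affineChart_affineChart_symm]
  rfl

/-- The density of the Fubini-Study volume in the affine charts. -/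
def fubiniStudyDensity (w : Fin N → ℂ) : ℝ := |topPower (fubiniStudyAt w)|

theorem fubiniStudyDensity_transition {i j : Fin (N + 1)} {w : Fin N → ℂ} (hw : homog i w j ≠ 0) :
    fubiniStudyDensity w =
      |(fderiv ℝ (transition i j) w).det| * fubiniStudyDensity (transition i j w) := by
  rw [fubiniStudyDensity, ← fubiniStudyAt_transition hw, topPower_compContinuousLinearMap, abs_mul]
  rfl

theorem continuous_fubiniStudyDensity : Continuous (fubiniStudyDensity (N := N)) := by
  have hne : ∀ w : Fin N → ℂ, (1 + ∑ i, (‖w i‖ : ℂ) ^ 2) ^ 2 ≠ 0 := fun w => by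
    have : (0 : ℝ) < 1 + ∑ i, ‖w i‖ ^ 2 := by positivity
    exact_mod_cast (pow_pos this 2).ne'
  have h1 : ∀ u v : Fin N → ℂ, Continuous fun w => fubiniStudyHermitian w u v := fun u v => by
    unfold fubiniStudyHermitian
    exact Continuous.div (by fun_prop) (by fun_prop) hne
  have h2 : ∀ u v : Fin N → ℂ, Continuous fun w => fubiniStudyAt w ![u, v] := fun u v => by
    simp only [fubiniStudyAt_apply]
    exact Complex.continuous_re.comp (continuous_const.mul ((h1 u v).sub (h1 v u)))
  unfold fubiniStudyDensity topPower
  exact (continuous_const.mul (continuous_finsetSum _ fun σ _ => continuous_const.mul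
    (continuous_finsetProd _ fun k _ => h2 _ _))).abs

/-- The point `w` enters the hermitian form only through terms of even degree. This symmetry later
gives the orthogonality of the coordinate sections. -/
theorem fubiniStudyDensity_neg (w : Fin N → ℂ) :
    fubiniStudyDensity (-w) = fubiniStudyDensity w := by
  have : fubiniStudyAt (-w) = fubiniStudyAt w := by
    ext u
    change (Complex.I * (fubiniStudyHermitian _ (u 0) (u 1) -
      fubiniStudyHermitian _ (u 1) (u 0))).re = (Complex.I * (fubiniStudyHermitian _ (u 0) (u 1) -
      fubiniStudyHermitian _ (u 1) (u 0))).re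
    simp [fubiniStudyHermitian]
  rw [fubiniStudyDensity, this, fubiniStudyDensity]

/-- At the origin the hermitian form is the standard one, and the two-form takes the value `2` on
each pair `e_k, i e_k`. By continuity, positivity at one point makes the volume non-zero. -/
theorem fubiniStudyDensity_zero_pos : 0 < fubiniStudyDensity (0 : Fin N → ℂ) := by
  have hH : ∀ u v : Fin N → ℂ, fubiniStudyHermitian 0 u v = ∑ i, u i * star (v i) := by
    simp [fubiniStudyHermitian]
  refine abs_pos.2 (lt_of_lt_of_le ?_ (le_topPower _ 2 ?_ ?_ zero_le_two)).ne'
  · positivity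
  · intro k
    simp [fubiniStudyAt_apply, hH, realFrame, Pi.single_apply]
    norm_num
  · intro p q hpq
    simp [fubiniStudyAt_apply, hH, realFrame, Pi.single_apply, hpq, hpq.symm]

end FubiniStudy

/-! ### The Fubini-Study volume: one chart suffices, finiteness, symmetry -/

section FubiniStudyVolume

variable {N : ℕ}

/-- The Fubini-Study volume in an affine chart. -/
def fubiniStudyVolume (N : ℕ) : Measure (Fin N → ℂ) :=
  volume.withDensity fun w => ENNReal.ofReal (fubiniStudyDensity w)

theorem continuous_affineChart_symm (i : Fin (N + 1)) : Continuous (affineChart i).symm :=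
  continuousOn_univ.1 (affineChart i).continuousOn_symm

theorem continuous_homog_coord (i k : Fin (N + 1)) : Continuous fun w : Fin N → ℂ => homog i w k :=
  (contDiff_homog i k).continuous

/-- The part of one affine chart missed by another is empty or a coordinate hyperplane, hence null.
-/
theorem ae_homog_ne_zero (i j : Fin (N + 1)) : ∀ᵐ w : Fin N → ℂ, homog i w j ≠ 0 := by
  rcases Fin.eq_self_or_eq_succAbove i j with rfl | ⟨k, rfl⟩
  · simp
  · simpa [volume_pi] using Measure.ae_eval_ne (fun _ : Fin N => (volume : Measure ℂ)) k 0

theorem transition_transition {i j : Fin (N + 1)} {w : Fin N → ℂ} (hw : homog i w j ≠ 0) :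
    transition j i (transition i j w) = w := by
  rw [← affineChart_affineChart_symm j i, affineChart_symm_transition hw,
    (affineChart i).right_inv (mem_univ w)]

theorem homog_transition_ne_zero {i j : Fin (N + 1)} {w : Fin N → ℂ} (hw : homog i w j ≠ 0) :
    homog j (transition i j w) i ≠ 0 := by
  simp [homog_transition hw, hw]

/-- Up to null sets both charts see only their overlap, where this is the change of variables
formula: the density picks up exactly the absolute value of the Jacobian determinant. -/
theorem map_fubiniStudyVolume_eq (i j : Fin (N + 1)) :
    (fubiniStudyVolume N).map (affineChart i).symm =
      (fubiniStudyVolume N).map (affineChart j).symm := by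
  have hrestr : ∀ (k l : Fin (N + 1)) (A : Set (PSpace N)), MeasurableSet A →
      (fubiniStudyVolume N).map (affineChart k).symm A =
        ∫⁻ w in (affineChart k).symm ⁻¹' A ∩ {w | homog k w l ≠ 0},
          ENNReal.ofReal (fubiniStudyDensity w) := by
    intro k l A hA
    have hm := (continuous_affineChart_symm k).measurable
    rw [Measure.map_apply hm hA, fubiniStudyVolume, withDensity_apply _ (hm hA)]
    refine setLIntegral_congr ?_
    filter_upwards [ae_homog_ne_zero k l] with w hw
    exact propext ⟨fun h => ⟨h, hw⟩, fun h => h.1⟩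
  ext A hA
  rw [hrestr i j A hA, hrestr j i A hA]
  have himage : transition i j '' ((affineChart i).symm ⁻¹' A ∩ {w | homog i w j ≠ 0}) =
      (affineChart j).symm ⁻¹' A ∩ {w | homog j w i ≠ 0} := by
    ext v
    constructor
    · rintro ⟨w, ⟨hwA, hw⟩, rfl⟩
      exact ⟨by rwa [mem_preimage, affineChart_symm_transition hw], homog_transition_ne_zero hw⟩
    · rintro ⟨hvA, hv⟩
      exact ⟨transition j i v, ⟨by rwa [mem_preimage, affineChart_symm_transition hv],
        homog_transition_ne_zero hv⟩, transition_transition hv⟩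
  have hmeas : MeasurableSet ((affineChart i).symm ⁻¹' A ∩ {w | homog i w j ≠ 0}) :=
    ((continuous_affineChart_symm i).measurable hA).inter
      (isOpen_ne_fun (continuous_homog_coord i j) continuous_const).measurableSet
  rw [← himage, lintegral_image_eq_lintegral_abs_det_fderiv_mul volume hmeas
    (fun w hw => (differentiableAt_transition hw.2).hasFDerivAt.hasFDerivWithinAt)
    (fun v hv w hw hvw => by rw [← transition_transition hv.2, hvw, transition_transition hw.2])]
  refine setLIntegral_congr_fun hmeas fun w hw => ?_
  rw [fubiniStudyDensity_transition hw.2, ENNReal.ofReal_mul (abs_nonneg _)]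

/-- The supremum over the atlas is taken over a constant family, so integrals over projective space
can be computed in any single affine chart. -/
theorem liouvilleMeasure_fubiniStudy (i : Fin (N + 1)) :
    liouvilleMeasure (fubiniStudy N) = (fubiniStudyVolume N).map (affineChart i).symm := by
  have h1 : ∀ j : Fin (N + 1), ((volume.restrict (affineChart j).target).withDensity
      fun z => ENNReal.ofReal |topPower (localForm (fubiniStudy N) (affineChart j) z)|).map
        (affineChart j).symm = (fubiniStudyVolume N).map (affineChart i).symm := fun j => by
    rw [← map_fubiniStudyVolume_eq j i]
    simp only [localForm_fubiniStudy]
    rw [show (affineChart j).target = univ from rfl, Measure.restrict_univ]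
    rfl
  change ⨆ φ ∈ range affineChart, _ = _
  rw [iSup_range]
  simp only [h1, ciSup_const]

/-- The points at which the `i`-th homogeneous coordinate has maximal absolute value. -/
def maximalSet (i : Fin (N + 1)) : Set (PSpace N) :=
  (affineChart i).source ∩ affineChart i ⁻¹' Metric.closedBall 0 1

theorem measurableSet_maximalSet (i : Fin (N + 1)) : MeasurableSet (maximalSet (N := N) i) := by
  have h1 : maximalSet (N := N) i = (affineChart i).source \
      ((affineChart i).source ∩ affineChart i ⁻¹' (Metric.closedBall 0 1)ᶜ) := by
    ext p
    simp only [maximalSet, mem_inter_iff, mem_preimage, mem_sdiff, mem_compl_iff]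
    tauto
  rw [h1]
  exact (affineChart i).open_source.measurableSet.diff ((affineChart i).isOpen_inter_preimage
    Metric.isClosed_closedBall.isOpen_compl).measurableSet

/-- Dividing by a coordinate of largest modulus covers projective space by `N + 1` closed unit
polydiscs. This serves as compactness, both for the finite volume and for the growth of sections. -/
theorem exists_mem_maximalSet (p : PSpace N) : ∃ i, p ∈ maximalSet i := by
  obtain ⟨i, -, hi⟩ := Finset.exists_max_image Finset.univ (fun i => ‖p.rep i‖) Finset.univ_nonempty
  have h0 : p.rep i ≠ 0 := fun h0 => by
    obtain ⟨j, hj⟩ := exists_rep_ne_zero p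
    have := hi j (Finset.mem_univ j)
    rw [h0, norm_zero] at this
    exact hj (norm_le_zero_iff.1 this)
  refine ⟨i, h0, ?_⟩
  rw [mem_preimage, mem_closedBall_zero_iff, pi_norm_le_iff_of_nonneg zero_le_one]
  intro k
  change ‖p.rep _ / p.rep i‖ ≤ 1
  rw [norm_div]
  exact div_le_one_of_le₀ (hi _ (Finset.mem_univ _)) (norm_nonneg _)

instance : IsLocallyFiniteMeasure (fubiniStudyVolume N) :=
  IsLocallyFiniteMeasure.withDensity_ofReal continuous_fubiniStudyDensity

instance : IsFiniteMeasure (liouvilleMeasure (fubiniStudy N)) := by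
  refine ⟨?_⟩
  have h1 : (univ : Set (PSpace N)) = ⋃ i, maximalSet i :=
    (eq_univ_of_forall fun p => mem_iUnion.2 (exists_mem_maximalSet p)).symm
  rw [h1]
  refine (measure_iUnion_le _).trans_lt ?_
  rw [tsum_fintype]
  refine ENNReal.sum_lt_top.2 fun i _ => ?_
  rw [liouvilleMeasure_fubiniStudy i, Measure.map_apply
    (continuous_affineChart_symm i).measurable (measurableSet_maximalSet i)]
  refine lt_of_le_of_lt (measure_mono ?_) (isCompact_closedBall (0 : Fin N → ℂ) 1).measure_lt_top
  intro w hw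
  have := hw.2
  rwa [mem_preimage, (affineChart i).right_inv (mem_univ w)] at this

theorem liouvilleMeasure_fubiniStudy_ne_zero : liouvilleMeasure (fubiniStudy N) ≠ 0 := by
  rw [liouvilleMeasure_fubiniStudy 0, Ne, Measure.map_eq_zero_iff
    (continuous_affineChart_symm 0).aemeasurable]
  intro h0
  have hcont : Continuous fun w : Fin N → ℂ => ENNReal.ofReal (fubiniStudyDensity w) :=
    ENNReal.continuous_ofReal.comp continuous_fubiniStudyDensity
  rw [fubiniStudyVolume, withDensity_eq_zero_iff hcont.measurable.aemeasurable] at h0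
  have h1 := (hcont.ae_eq_iff_eq volume continuous_const).1 h0
  have h2 := congrFun h1 0
  exact (ENNReal.ofReal_pos.2 fubiniStudyDensity_zero_pos).ne' h2

instance : (fubiniStudyVolume N).IsNegInvariant := by
  refine ⟨?_⟩
  ext A hA
  rw [Measure.neg_apply, fubiniStudyVolume, withDensity_apply _ hA, withDensity_apply _ hA.neg]
  have h1 := (Measure.measurePreserving_neg (volume : Measure (Fin N → ℂ))).setLIntegral_comp_preimage
    hA (f := fun w => ENNReal.ofReal (fubiniStudyDensity w))
    (ENNReal.continuous_ofReal.comp continuous_fubiniStudyDensity).measurable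
  simp only [fubiniStudyDensity_neg] at h1
  exact h1

end FubiniStudyVolume

/-! ### Local representatives of sections of the hyperplane bundle -/

section HyperplaneSections

variable {N : ℕ}

theorem homog_affineChart {i : Fin (N + 1)} {p : PSpace N} (hp : p ∈ affineSet i)
    (k : Fin (N + 1)) : homog i (affineChart i p) k = ratio k i p := by
  rcases Fin.eq_self_or_eq_succAbove i k with h | ⟨l, rfl⟩
  · subst h
    have : p.rep k ≠ 0 := hp
    simp [ratio, this]
  · exact homog_succAbove i _ l

theorem ratio_mul_ratio {i : Fin (N + 1)} {p : PSpace N} (hp : p ∈ affineSet i)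
    (j k : Fin (N + 1)) : ratio i j p * ratio k i p = ratio k j p := by
  have : p.rep i ≠ 0 := hp
  rw [ratio, ratio, ratio]
  field_simp

theorem contMDiffOn_ratio_affineSet (k i : Fin (N + 1)) :
    ContMDiffOn 𝓘(ℂ, Fin N → ℂ) 𝓘(ℂ) ω (ratio (N := N) k i) (affineSet i) := by
  have hc : ContMDiffOn 𝓘(ℂ, Fin N → ℂ) 𝓘(ℂ, Fin N → ℂ) ω (affineChart (N := N) i)
      (affineSet i) :=
    contMDiffOn_of_mem_maximalAtlas
      (IsManifold.subset_maximalAtlas (mem_range_self (f := affineChart) i))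
  exact ((contDiff_homog i k).contMDiff.comp_contMDiffOn hc).congr
    fun p hp => (homog_affineChart hp k).symm

/-- The coordinate of an element of a fibre of the hyperplane bundle in the preferred
trivialization. -/
def fibreCoord {p : PSpace N} (v : Hyperplane N p) : ℂ := v

theorem localTriv_apply_snd (i : Fin (N + 1)) (p : PSpace N) (v : Hyperplane N p) :
    ((hyperplaneCore N).localTriv i ⟨p, v⟩).2 = ratio (indexAt p) i p * fibreCoord v := rfl

instance (i : Fin (N + 1)) : MemTrivializationAtlas ((hyperplaneCore N).localTriv i) := ⟨⟨i, rfl⟩⟩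

/-- The section of the hyperplane bundle given by the `j`-th homogeneous coordinate. -/
def coordSection (j : Fin (N + 1)) : HolSection N (Hyperplane N) where
  toFun p := (ratio j (indexAt p) p : ℂ)
  contMDiff_toFun p := by
    have h1 : ContMDiffAt 𝓘(ℂ, Fin N → ℂ) 𝓘(ℂ) ω (ratio (N := N) j (indexAt p)) p :=
      (contMDiffOn_ratio_affineSet j (indexAt p)).contMDiffAt
        ((isOpen_affineSet _).mem_nhds (mem_affineSet_indexAt p))
    -- The preferred index may jump near `p`, but in the trivialization fixed at `p` the jumping
    -- factors cancel and leave `z_j / z_k` with `k = indexAt p`.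
    refine (contMDiffAt_section p).2
      (h1.congr_of_eventuallyEq (Filter.Eventually.of_forall fun y => ?_))
    exact ratio_mul_ratio (mem_affineSet_indexAt y) _ _

theorem fibreCoord_coordSection (j : Fin (N + 1)) (p : PSpace N) :
    fibreCoord (coordSection j p) = ratio j (indexAt p) p := rfl

/-- The function representing a section of the hyperplane bundle in the `i`-th affine chart and
trivialization. -/
def localSection (s : HolSection N (Hyperplane N)) (i : Fin (N + 1)) (w : Fin N → ℂ) : ℂ :=
  ((hyperplaneCore N).localTriv i ⟨(affineChart i).symm w, s ((affineChart i).symm w)⟩).2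

theorem contDiff_localSection (s : HolSection N (Hyperplane N)) (i : Fin (N + 1)) :
    ContDiff ℂ ω (localSection s i) := by
  have h1 : ContMDiffOn 𝓘(ℂ, Fin N → ℂ) 𝓘(ℂ) ω
      (fun p => ((hyperplaneCore N).localTriv i ⟨p, s p⟩).2) (affineSet i) :=
    (((hyperplaneCore N).localTriv i).contMDiffOn_section_baseSet_iff).1 s.contMDiff.contMDiffOn
  have h2 : ContMDiffOn 𝓘(ℂ, Fin N → ℂ) 𝓘(ℂ, Fin N → ℂ) ω (affineChart (N := N) i).symm univ :=
    contMDiffOn_symm_of_mem_maximalAtlas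
      (IsManifold.subset_maximalAtlas (mem_range_self (f := affineChart) i))
  rw [← contMDiff_iff_contDiff, ← contMDiffOn_univ]
  exact h1.comp h2 fun w _ => (affineChart i).map_target (mem_univ w)

theorem localSection_transition (s : HolSection N (Hyperplane N)) {i j : Fin (N + 1)}
    {w : Fin N → ℂ} (hw : homog i w j ≠ 0) :
    localSection s i w = homog i w j * localSection s j (transition i j w) := by
  rw [localSection, localSection, affineChart_symm_transition hw, localTriv_apply_snd,
    localTriv_apply_snd]
  have h1 : ratio j i ((affineChart i).symm w) = homog i w j := by
    rw [affineChart_symm_apply, ratio_mk, homog_same, div_one]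
  have hj : ((affineChart i).symm w).rep j ≠ 0 := (affineChart_symm_mem i j w).2 hw
  rw [← h1, ← mul_assoc]
  congr 1
  rw [ratio, ratio, ratio]
  field_simp

theorem fibreCoord_eq_localSection (s : HolSection N (Hyperplane N)) {i : Fin (N + 1)} {p : PSpace N}
    (hp : p ∈ affineSet i) :
    fibreCoord (s p) = ratio i (indexAt p) p * localSection s i (affineChart i p) := by
  have hp' : (affineChart i).symm (affineChart i p) = p := (affineChart i).left_inv hp
  rw [localSection, hp', localTriv_apply_snd, ← mul_assoc, ratio_mul_ratio hp]
  have : p.rep (indexAt p) ≠ 0 := mem_affineSet_indexAt p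
  rw [ratio, div_self this, one_mul]

/-- The local representatives of a section grow at most linearly. -/
theorem exists_norm_localSection_le (s : HolSection N (Hyperplane N)) :
    ∃ C, 0 ≤ C ∧ ∀ i w, ‖localSection s i w‖ ≤ C * (1 + ‖w‖) := by
  have h1 : ∀ j, ∃ C, ∀ v ∈ Metric.closedBall (0 : Fin N → ℂ) 1, ‖localSection s j v‖ ≤ C :=
    fun j => (isCompact_closedBall _ _).exists_bound_of_continuousOn
      (contDiff_localSection s j).continuous.continuousOn
  choose C hC using h1
  have hC0 : ∀ j, 0 ≤ C j := fun j =>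
    (norm_nonneg _).trans (hC j 0 (Metric.mem_closedBall_self zero_le_one))
  refine ⟨∑ j, C j, Finset.sum_nonneg fun j _ => hC0 j, fun i w => ?_⟩
  -- In the chart of a maximal coordinate the point lies in the unit polydisc, where the
  -- representative is bounded; the transition factor `homog i w j` supplies the linear growth.
  obtain ⟨j, hj⟩ := exists_mem_maximalSet ((affineChart i).symm w)
  have hw : homog i w j ≠ 0 := (affineChart_symm_mem i j w).1 hj.1
  have hv : transition i j w ∈ Metric.closedBall 0 1 := by
    rw [← affineChart_affineChart_symm]
    exact hj.2
  have hh : ‖homog i w j‖ ≤ 1 + ‖w‖ := by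
    rcases Fin.eq_self_or_eq_succAbove i j with h | ⟨k, rfl⟩
    · subst h
      simp
    · rw [homog_succAbove]
      exact (norm_le_pi_norm w k).trans (by linarith)
  rw [localSection_transition s hw, norm_mul, mul_comm]
  exact mul_le_mul ((hC j _ hv).trans (Finset.single_le_sum (fun j _ => hC0 j)
    (Finset.mem_univ j))) hh (norm_nonneg _) (Finset.sum_nonneg fun j _ => hC0 j)

/-- An entire function of linear growth is affine. -/
theorem exists_affine_of_linear_growth {f : (Fin N → ℂ) → ℂ} (hf : ContDiff ℂ ω f) {C : ℝ}
    (hC : ∀ w, ‖f w‖ ≤ C * (1 + ‖w‖)) (w : Fin N → ℂ) : f w = f 0 + fderiv ℂ f 0 w := by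
  -- On the complex line through `w` the derivative is bounded by Cauchy's estimate, hence constant
  -- by Liouville's theorem.
  let g : ℂ → ℂ := fun t => f (t • w)
  have hg : ContDiff ℂ ω g := hf.comp (contDiff_id.smul contDiff_const)
  have hC0 : 0 ≤ C := by simpa using (norm_nonneg _).trans (hC 0)
  have hbound : ∀ t, ‖deriv g t‖ ≤ C * (1 + 2 * ‖w‖) := by
    intro t
    -- A radius growing with `t` absorbs the linear growth: on the circle `‖u‖ ≤ 2 (1 + ‖t‖)`, so
    -- the bound on `g` is a constant times the radius.
    have hR : (0 : ℝ) < 1 + ‖t‖ := by positivity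
    have h1 : ∀ u ∈ Metric.sphere t (1 + ‖t‖), ‖g u‖ ≤ C * (1 + 2 * ‖w‖) * (1 + ‖t‖) := by
      intro u hu
      have h2 : ‖u‖ ≤ 2 * (1 + ‖t‖) := by
        have h3 : ‖u - t‖ = 1 + ‖t‖ := by rwa [mem_sphere_iff_norm] at hu
        have h4 := norm_add_le (u - t) t
        rw [sub_add_cancel, h3] at h4
        linarith
      refine (hC _).trans ?_
      rw [mul_assoc]
      refine mul_le_mul_of_nonneg_left ?_ hC0
      rw [norm_smul]
      nlinarith [norm_nonneg t, mul_le_mul_of_nonneg_right h2 (norm_nonneg w)]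
    refine (Complex.norm_deriv_le_of_forall_mem_sphere_norm_le hR
      (hg.differentiable (by simp)).diffContOnCl h1).trans_eq ?_
    field_simp
  have hdiff : Differentiable ℂ (deriv g) :=
    (hg.differentiable (by simp)).deriv
  have hconst : ∀ t, deriv g t = deriv g 0 := fun t =>
    hdiff.apply_eq_apply_of_bounded
      (isBounded_iff_forall_norm_le.2 ⟨_, forall_mem_range.2 hbound⟩) t 0
  have hder0 : deriv g 0 = fderiv ℂ f 0 w := by
    have h1 : HasFDerivAt f (fderiv ℂ f 0) ((0 : ℂ) • w) := by
      rw [zero_smul]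
      exact ((hf.differentiable (by simp)) 0).hasFDerivAt
    have h2 : HasDerivAt (fun t : ℂ => t • w) w 0 := by
      simpa using (hasDerivAt_id (0 : ℂ)).smul_const w
    exact (h1.comp_hasDerivAt 0 h2).deriv
  have hk : ∀ t, HasDerivAt (fun t => g t - t * fderiv ℂ f 0 w) 0 t := fun t => by
    have h1 := ((hg.differentiable (by simp)) t).hasDerivAt.sub
      ((hasDerivAt_id t).mul_const (fderiv ℂ f 0 w))
    rwa [hconst, hder0, one_mul, sub_self] at h1
  have h2 := is_const_of_deriv_eq_zero (fun t => (hk t).differentiableAt) (fun t => (hk t).deriv) 1 0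
  simp only [g, one_smul, zero_smul, one_mul, zero_mul, sub_zero] at h2
  rw [← h2, sub_add_cancel]

end HyperplaneSections

/-! ### The orthonormal basis of homogeneous coordinates -/

section HyperplaneBasis

variable {N : ℕ}

/-- The coordinate of the value of a section of the hyperplane bundle at `p`, as a linear form. -/
def evalCoord (p : PSpace N) : HolSection N (Hyperplane N) →ₗ[ℂ] ℂ where
  toFun s := fibreCoord (s p)
  map_add' _ _ := rfl
  map_smul' _ _ := rfl

theorem exists_localSection_eq_sum (s : HolSection N (Hyperplane N)) (i : Fin (N + 1)) :
    ∃ a : Fin (N + 1) → ℂ, ∀ w, localSection s i w = ∑ k, a k * homog i w k := by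
  obtain ⟨C, -, hC⟩ := exists_norm_localSection_le s
  let f := localSection s i
  -- The constant term of the affine function is the coefficient of the coordinate normalized to
  -- `1`.
  refine ⟨i.insertNth (f 0) fun l => fderiv ℂ f 0 (Pi.single l 1), fun w => ?_⟩
  have h1 : fderiv ℂ f 0 w = ∑ l, w l • fderiv ℂ f 0 (Pi.single l 1) := by
    conv_lhs => rw [pi_eq_sum_univ' w, map_sum]
    refine Finset.sum_congr rfl fun l _ => ?_
    rw [map_smul]
  rw [exists_affine_of_linear_growth (contDiff_localSection s i) (hC i) w, h1,
    Fin.sum_univ_succAbove _ i]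
  simp [mul_comm, f]

/-- Every global holomorphic section of the hyperplane bundle is a linear form in the homogeneous
coordinates. -/
theorem exists_eq_sum_coordSection (s : HolSection N (Hyperplane N)) :
    ∃ a : Fin (N + 1) → ℂ, ∑ k, a k • coordSection k = s := by
  obtain ⟨a, ha⟩ := exists_localSection_eq_sum s 0
  -- The coefficients found in chart `0` serve every chart: the two sides agree off a null set and
  -- are continuous.
  have hall : ∀ i, localSection s i = fun w => ∑ k, a k * homog i w k := fun i => by
    have hcont : Continuous fun w : Fin N → ℂ => ∑ k, a k * homog i w k :=
      continuous_finsetSum _ fun k _ => continuous_const.mul (continuous_homog_coord i k)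
    refine ((contDiff_localSection s i).continuous.ae_eq_iff_eq volume hcont).1 ?_
    filter_upwards [ae_homog_ne_zero i 0] with w hw
    rw [localSection_transition s hw, ha, homog_transition hw, Finset.mul_sum]
    refine Finset.sum_congr rfl fun k _ => ?_
    rw [PiLp.smul_apply, smul_eq_mul]
    field_simp
  refine ⟨a, ContMDiffSection.ext fun p => ?_⟩
  have hp := mem_affineSet_indexAt p
  have h1 : fibreCoord (s p) = ∑ k, a k * ratio k (indexAt p) p := by
    have h2 : p.rep (indexAt p) ≠ 0 := hp
    rw [fibreCoord_eq_localSection s hp, hall, ratio, div_self h2, one_mul]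
    simp only [homog_affineChart hp]
  have h3 : evalCoord p (∑ k, a k • coordSection k) = ∑ k, a k * ratio k (indexAt p) p := by
    rw [map_sum]
    exact Finset.sum_congr rfl fun k _ => by rw [map_smul]; rfl
  exact h3.trans h1.symm

theorem span_coordSection :
    ⊤ ≤ Submodule.span ℂ (range (coordSection : Fin (N + 1) → HolSection N (Hyperplane N))) :=
  fun s _ => (Submodule.mem_span_range_iff_exists_fun ℂ).2 (exists_eq_sum_coordSection s)

theorem hyperplaneMetric_apply (p : PSpace N) (v w : Hyperplane N p) :
    hyperplaneMetric N p v w = (((1 + ∑ k, ‖chartAt (Fin N → ℂ) p p k‖ ^ 2)⁻¹ : ℝ) : ℂ) *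
      (starRingEnd ℂ (fibreCoord v) * fibreCoord w) := rfl

/-- The modulus squared of the preferred coordinate cancels between the two section values and `1 +
‖w‖²`. The result no longer refers to a chart and is bounded by `1`. -/
theorem hyperplaneMetric_coordSection (v : EuclideanSpace ℂ (Fin (N + 1))) (hv : v ≠ 0)
    (a b : Fin (N + 1)) :
    hyperplaneMetric N (Projectivization.mk ℂ v hv) (coordSection a _) (coordSection b _) =
      starRingEnd ℂ (v a) * v b * (((∑ k, ‖v k‖ ^ 2)⁻¹ : ℝ) : ℂ) := by
  rw [hyperplaneMetric_apply, fibreCoord_coordSection, fibreCoord_coordSection]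
  set p := Projectivization.mk ℂ v hv with hp
  have hj : v (indexAt p) ≠ 0 := (mk_mem_affineSet v hv _).1 (mem_affineSet_indexAt p)
  have h1 : 1 + ∑ k, ‖chartAt (Fin N → ℂ) p p k‖ ^ 2 =
      (∑ k, ‖v k‖ ^ 2) * (‖v (indexAt p)‖ ^ 2)⁻¹ := by
    have h2 : ∀ k, ‖chartAt (Fin N → ℂ) p p k‖ ^ 2 =
        ‖v ((indexAt p).succAbove k)‖ ^ 2 * (‖v (indexAt p)‖ ^ 2)⁻¹ := fun k => by
      have : chartAt (Fin N → ℂ) p p k = v ((indexAt p).succAbove k) / v (indexAt p) :=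
        ratio_mk v hv _ _
      rw [this, norm_div, div_pow, div_eq_mul_inv]
    have h3 : ‖v (indexAt p)‖ ^ 2 ≠ 0 := pow_ne_zero 2 (norm_ne_zero_iff.2 hj)
    simp only [h2]
    rw [← Finset.sum_mul, Fin.sum_univ_succAbove _ (indexAt p), add_mul, mul_inv_cancel₀ h3]
  rw [h1, hp, ratio_mk, ratio_mk, ← hp, mul_inv, inv_inv, Complex.ofReal_mul, Complex.ofReal_pow,
    ← Complex.conj_mul', map_div₀]
  have hj' : starRingEnd ℂ (v (indexAt p)) ≠ 0 := (map_ne_zero _).2 hj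
  field_simp

theorem measurableEmbedding_affineChart_symm (i : Fin (N + 1)) :
    MeasurableEmbedding (affineChart i).symm :=
  ((affineChart i).symm.isOpenEmbedding rfl).measurableEmbedding

theorem hyperplaneMetric_affineChart_symm (i a b : Fin (N + 1)) (w : Fin N → ℂ) :
    hyperplaneMetric N ((affineChart i).symm w) (coordSection a _) (coordSection b _) =
      starRingEnd ℂ (homog i w a) * homog i w b * (((1 + ∑ k, ‖w k‖ ^ 2)⁻¹ : ℝ) : ℂ) := by
  rw [affineChart_symm_apply, hyperplaneMetric_coordSection, Fin.sum_univ_succAbove _ i]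
  simp only [homog_same, homog_succAbove, norm_one, one_pow]

theorem integrable_hyperplaneMetric_coordSection (a b : Fin (N + 1)) :
    Integrable (fun p => hyperplaneMetric N p (coordSection a p) (coordSection b p))
      (liouvilleMeasure (fubiniStudy N)) := by
  refine Integrable.of_bound (C := 1) ?_ (Filter.Eventually.of_forall fun p => ?_)
  · rw [liouvilleMeasure_fubiniStudy 0,
      (measurableEmbedding_affineChart_symm 0).aestronglyMeasurable_map_iff]
    refine Continuous.aestronglyMeasurable ?_
    have heq : ((fun p => hyperplaneMetric N p (coordSection a p) (coordSection b p)) ∘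
        (affineChart 0).symm) = fun w => starRingEnd ℂ (homog 0 w a) * homog 0 w b *
          (((1 + ∑ k, ‖w k‖ ^ 2)⁻¹ : ℝ) : ℂ) :=
      funext fun w => hyperplaneMetric_affineChart_symm 0 a b w
    rw [heq]
    refine ((Complex.continuous_conj.comp (continuous_homog_coord 0 a)).mul
      (continuous_homog_coord 0 b)).mul (Complex.continuous_ofReal.comp
        (Continuous.inv₀ (by fun_prop) fun w => ?_))
    positivity
  · induction p using Projectivization.ind with
    | h v hv =>
      rw [hyperplaneMetric_coordSection, norm_mul, norm_mul, RCLike.norm_conj, Complex.norm_real]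
      have hle : ∀ k, ‖v k‖ ^ 2 ≤ ∑ k, ‖v k‖ ^ 2 := fun k =>
        Finset.single_le_sum (f := fun k => ‖v k‖ ^ 2) (fun _ _ => by positivity)
          (Finset.mem_univ k)
      have h0 : 0 ≤ ∑ k, ‖v k‖ ^ 2 := Finset.sum_nonneg fun _ _ => by positivity
      rw [Real.norm_of_nonneg (inv_nonneg.2 h0), ← div_eq_mul_inv]
      refine div_le_one_of_le₀ ?_ h0
      nlinarith [hle a, hle b, sq_nonneg (‖v a‖ - ‖v b‖)]

theorem sectionInner_coordSection (i a b : Fin (N + 1)) :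
    sectionInner (fubiniStudy N) (hyperplaneMetric N) (coordSection a) (coordSection b) =
      ∫ w, starRingEnd ℂ (homog i w a) * homog i w b * (((1 + ∑ k, ‖w k‖ ^ 2)⁻¹ : ℝ) : ℂ)
        ∂(fubiniStudyVolume N) := by
  rw [sectionInner, liouvilleMeasure_fubiniStudy i,
    (measurableEmbedding_affineChart_symm i).integral_map]
  simp only [hyperplaneMetric_affineChart_symm]

/-- In the `a`-th chart the integrand is `w_l / (1 + ‖w‖²)`, an odd function, while the volume is
invariant under `w ↦ -w`. -/
theorem sectionInner_coordSection_of_ne {a b : Fin (N + 1)} (hab : a ≠ b) :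
    sectionInner (fubiniStudy N) (hyperplaneMetric N) (coordSection a) (coordSection b) = 0 := by
  obtain ⟨l, rfl⟩ := Fin.exists_succAbove_eq hab.symm
  rw [sectionInner_coordSection a]
  simp only [homog_same, homog_succAbove, map_one, one_mul]
  have h1 := integral_neg_eq_self (μ := fubiniStudyVolume N)
    fun w => w l * (((1 + ∑ k, ‖w k‖ ^ 2)⁻¹ : ℝ) : ℂ)
  simp only [Pi.neg_apply, norm_neg, neg_mul, integral_neg] at h1
  exact neg_eq_self.1 h1

/-- The square of the norm of the sections given by the homogeneous coordinates. -/
def coordNormSq (N : ℕ) : ℝ := ∫ w, (1 + ∑ k, ‖w k‖ ^ 2)⁻¹ ∂(fubiniStudyVolume N)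

/-- Computed in its own chart, each coordinate section is represented by `1`, so the integral does
not depend on `a`. -/
theorem sectionInner_coordSection_self (a : Fin (N + 1)) :
    sectionInner (fubiniStudy N) (hyperplaneMetric N) (coordSection a) (coordSection a) =
      (coordNormSq N : ℂ) := by
  rw [sectionInner_coordSection a]
  simp only [homog_same, map_one, one_mul]
  exact integral_ofReal

theorem coordNormSq_pos : 0 < coordNormSq N := by
  have hpos : ∀ w : Fin N → ℂ, 0 < (1 + ∑ k, ‖w k‖ ^ 2)⁻¹ := fun w => by positivity
  have hint : Integrable (fun w : Fin N → ℂ => (1 + ∑ k, ‖w k‖ ^ 2)⁻¹) (fubiniStudyVolume N) := by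
    have h1 := integrable_hyperplaneMetric_coordSection (N := N) 0 0
    rw [liouvilleMeasure_fubiniStudy 0,
      (measurableEmbedding_affineChart_symm 0).integrable_map_iff] at h1
    refine h1.re.congr (Filter.Eventually.of_forall fun w => ?_)
    simp only [Function.comp_apply, hyperplaneMetric_affineChart_symm, homog_same, map_one, one_mul]
    exact Complex.ofReal_re _
  rw [coordNormSq, integral_pos_iff_support_of_nonneg (fun w => (hpos w).le) hint,
    show Function.support (fun w : Fin N → ℂ => (1 + ∑ k, ‖w k‖ ^ 2)⁻¹) = univ from
      eq_univ_of_forall fun w => (hpos w).ne', Measure.measure_univ_pos]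
  intro h0
  refine liouvilleMeasure_fubiniStudy_ne_zero (N := N) ?_
  rw [liouvilleMeasure_fubiniStudy 0, h0, Measure.map_zero]

theorem integrable_hyperplaneMetric (s t : HolSection N (Hyperplane N)) :
    Integrable (fun p => hyperplaneMetric N p (s p) (t p)) (liouvilleMeasure (fubiniStudy N)) :=
  integrable_metric_of_span span_coordSection integrable_hyperplaneMetric_coordSection s t

theorem linearIndependent_coordSection :
    LinearIndependent ℂ (coordSection : Fin (N + 1) → HolSection N (Hyperplane N)) := by
  rw [Fintype.linearIndependent_iff]
  intro g hg a
  have h1 : ∀ b, sectionForm integrable_hyperplaneMetric (coordSection a) (coordSection b) =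
      if a = b then (coordNormSq N : ℂ) else 0 := fun b => by
    split_ifs with hab
    · subst hab
      exact sectionInner_coordSection_self a
    · exact sectionInner_coordSection_of_ne hab
  have h2 := congrArg (sectionForm integrable_hyperplaneMetric (coordSection a)) hg
  simpa [h1, coordNormSq_pos.ne'] using h2

/-- The orthonormal basis of the space of sections of the hyperplane bundle given by the normalized
homogeneous coordinates. -/
def hyperplaneBasis (N : ℕ) : Module.Basis (Fin (N + 1)) ℂ (HolSection N (Hyperplane N)) :=
  (Module.Basis.mk linearIndependent_coordSection span_coordSection).unitsSMul fun _ =>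
    Units.mk0 ((√(coordNormSq N))⁻¹ : ℂ)
      (inv_ne_zero (Complex.ofReal_ne_zero.2 (Real.sqrt_pos.2 coordNormSq_pos).ne'))

theorem hyperplaneBasis_apply (a : Fin (N + 1)) :
    hyperplaneBasis N a = ((√(coordNormSq N))⁻¹ : ℂ) • coordSection a := by
  rw [hyperplaneBasis, Module.Basis.unitsSMul_apply, Module.Basis.mk_apply]
  rfl

theorem sectionInner_hyperplaneBasis (a b : Fin (N + 1)) :
    sectionInner (fubiniStudy N) (hyperplaneMetric N) (hyperplaneBasis N a) (hyperplaneBasis N b) =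
      if a = b then 1 else 0 := by
  change sectionForm integrable_hyperplaneMetric _ _ = _
  have hc : ((√(coordNormSq N) : ℝ) : ℂ) ^ 2 = (coordNormSq N : ℂ) := by
    rw [← Complex.ofReal_pow, Real.sq_sqrt coordNormSq_pos.le]
  have hc0 : ((√(coordNormSq N) : ℝ) : ℂ) ≠ 0 :=
    Complex.ofReal_ne_zero.2 (Real.sqrt_pos.2 coordNormSq_pos).ne'
  simp only [hyperplaneBasis_apply, LinearMap.map_smulₛₗ, LinearMap.smul_apply, map_smul, map_inv₀,
    Complex.conj_ofReal]
  split_ifs with hab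
  · subst hab
    rw [show sectionForm integrable_hyperplaneMetric (coordSection a) (coordSection a) = _ from
      sectionInner_coordSection_self a, ← hc, smul_eq_mul, smul_eq_mul]
    field_simp
  · rw [show sectionForm integrable_hyperplaneMetric (coordSection a) (coordSection b) = _ from
      sectionInner_coordSection_of_ne hab, smul_zero, smul_zero]

theorem noCommonZero_hyperplane : NoCommonZero N (Hyperplane N) := fun p => by
  refine ⟨coordSection (indexAt p), fun h0 => ?_⟩
  have h1 : fibreCoord (coordSection (indexAt p) p) = 0 := h0
  have h2 : p.rep (indexAt p) ≠ 0 := mem_affineSet_indexAt p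
  rw [fibreCoord_coordSection, ratio, div_self h2] at h1
  exact one_ne_zero h1

/-- All homogeneous coordinates are normalized by the same constant, which disappears in projective
space; hence the coherent state map of projective space is the identity. -/
theorem projectiveMap_hyperplaneBasis (p : PSpace N) :
    projectiveMap noCommonZero_hyperplane (hyperplaneBasis N) p = p := by
  let q : Hyperplane N p := (1 : ℂ)
  have hq : q ≠ 0 := one_ne_zero (α := ℂ)
  have h1 : ∀ a, qhat q (hyperplaneBasis N a) =
      (√(coordNormSq N) : ℂ)⁻¹ * (p.rep (indexAt p))⁻¹ * p.rep a := fun a => by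
    refine qhat_eq hq ?_
    rw [hyperplaneBasis_apply]
    change (√(coordNormSq N) : ℂ)⁻¹ * (p.rep a / p.rep (indexAt p)) = _ * (1 : ℂ)
    ring
  conv_rhs => rw [← p.mk_rep]
  rw [projectiveMap_eq noCommonZero_hyperplane _ hq, Projectivization.mk_eq_mk_iff']
  refine ⟨(√(coordNormSq N) : ℂ)⁻¹ * (p.rep (indexAt p))⁻¹, ?_⟩
  ext a
  exact (h1 a).symm

/-- The cyclic `m`-point function of projective space in homogeneous coordinates. -/
theorem mPoint_fubiniStudy {m : ℕ} (p : Fin m → PSpace N)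
    (z : Fin m → EuclideanSpace ℂ (Fin (N + 1))) (hz : ∀ k, z k ≠ 0)
    (hzp : ∀ k, Projectivization.mk ℂ (z k) (hz k) = p k) :
    mPoint (fubiniStudy N) (hyperplaneMetric N) p =
      (∏ k, inner ℂ (z (finRotate m k)) (z k)) / ∏ k, ((‖z k‖ ^ 2 : ℝ) : ℂ) :=
  mPointLift_eq_of_mk_eq integrable_hyperplaneMetric sectionInner_hyperplaneBasis
    noCommonZero_hyperplane p _ (fun _ => fibreElement_ne_zero _) z hz
    fun k => by rw [projectiveMap_hyperplaneBasis, hzp]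

end HyperplaneBasis

end CoherentState

end

/-! ### The theorem -/

theorem propositionP {n : ℕ} {M : Type*} [TopologicalSpace M] [T2Space M] [CompactSpace M]
    [ChartedSpace (Fin n → ℂ) M] [IsManifold 𝓘(ℂ, Fin n → ℂ) ω M]
    [MeasurableSpace M] [BorelSpace M]
    (κ : CoherentState.TwoForm n M) (hκ : CoherentState.IsKahlerForm κ)
    {L : M → Type*} [∀ x, AddCommGroup (L x)] [∀ x, Module ℂ (L x)]
    [∀ x, TopologicalSpace (L x)] [TopologicalSpace (TotalSpace ℂ L)] [FiberBundle ℂ L]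
    [VectorBundle ℂ ℂ L] [ContMDiffVectorBundle ω ℂ L 𝓘(ℂ, Fin n → ℂ)]
    (h : ∀ x, L x →ₗ⋆[ℂ] L x →ₗ[ℂ] ℂ) (hh : CoherentState.IsHermitianMetric n h)
    (hquant : CoherentState.QuantumCondition κ h) (hL : CoherentState.IsVeryAmple n L)
    {N : ℕ} (s : Module.Basis (Fin (N + 1)) ℂ (CoherentState.HolSection n L))
    (hs : ∀ i j, CoherentState.sectionInner κ h (s i) (s j) = if i = j then 1 else 0)
    (i : M → CoherentState.PSpace N)
    (hi : i = CoherentState.projectiveMap hL.noCommonZero s)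
    {m : ℕ} (hm : 2 ≤ m) (x : Fin m → M) :
    (∀ q : ∀ k, L (x k), (∀ k, q k ≠ 0) →
      CoherentState.mPointLift κ h x q = CoherentState.mPoint κ h x) ∧
    CoherentState.mPoint κ h x =
      CoherentState.mPoint (CoherentState.fubiniStudy N) (CoherentState.hyperplaneMetric N)
        (fun k => i (x k)) ∧
    (∀ (z : Fin m → EuclideanSpace ℂ (Fin (N + 1))) (hz : ∀ k, z k ≠ 0),
      (∀ k, Projectivization.mk ℂ (z k) (hz k) = i (x k)) →
      CoherentState.mPoint κ h x =
        (∏ k, inner ℂ (z (finRotate m k)) (z k)) / ∏ k, ((‖z k‖ ^ 2 : ℝ) : ℂ)) ∧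
    ∀ j : ℕ, CoherentState.mPoint κ h (fun k => x ((finRotate m ^ j) k)) =
      CoherentState.mPoint κ h x := by
  subst hi
  have hint : ∀ t t' : CoherentState.HolSection n L,
      Integrable (fun x => h x (t x) (t' x)) (CoherentState.liouvilleMeasure κ) :=
    CoherentState.integrable_metric hh s fun i => by simp [hs]
  have hlift : ∀ q : ∀ k, L (x k), (∀ k, q k ≠ 0) →
      ∀ (z : Fin m → EuclideanSpace ℂ (Fin (N + 1))) (hz : ∀ k, z k ≠ 0),
      (∀ k, Projectivization.mk ℂ (z k) (hz k) =
        CoherentState.projectiveMap hL.noCommonZero s (x k)) →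
      CoherentState.mPointLift κ h x q =
        (∏ k, inner ℂ (z (finRotate m k)) (z k)) / ∏ k, ((‖z k‖ ^ 2 : ℝ) : ℂ) :=
    CoherentState.mPointLift_eq_of_mk_eq hint hs hL.noCommonZero x
  have hfib : ∀ k, CoherentState.fibreElement L (x k) ≠ 0 := fun k =>
    CoherentState.fibreElement_ne_zero (x k)
  have hrep := fun k => (CoherentState.projectiveMap hL.noCommonZero s (x k)).rep_nonzero
  have hmk := fun k => (CoherentState.projectiveMap hL.noCommonZero s (x k)).mk_rep
  refine ⟨fun q hq => ?_, ?_, fun z hz hzx => hlift _ hfib z hz hzx, fun j => ?_⟩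
  · rw [hlift q hq _ hrep hmk]
    exact (hlift _ hfib _ hrep hmk).symm
  -- The same representatives of the points `i (x k)` evaluate both sides.
  · rw [CoherentState.mPoint_fubiniStudy _ _ hrep hmk]
    exact hlift _ hfib _ hrep hmk
  -- A power of the rotation commutes with the rotation, so it maps neighbouring pairs to
  -- neighbouring pairs and only reindexes the products.
  · have hcomm : ∀ k, (finRotate m ^ j) (finRotate m k) = finRotate m ((finRotate m ^ j) k) :=
      fun k => by rw [← Equiv.Perm.mul_apply, ← Equiv.Perm.mul_apply, pow_mul_comm']
    let G (y y' : M) : ℂ := CoherentState.sectionInner κ h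
      (CoherentState.coherentVector κ h (CoherentState.fibreElement L y))
      (CoherentState.coherentVector κ h (CoherentState.fibreElement L y'))
    have hG : ∀ y : Fin m → M, CoherentState.mPoint κ h y =
        (∏ k, G (y k) (y (finRotate m k))) / ∏ k, G (y k) (y k) := fun _ => rfl
    rw [hG, hG]
    simp only [hcomm]
    congr 1
    · exact Equiv.prod_comp (finRotate m ^ j) fun k => G (x k) (x (finRotate m k))
    · exact Equiv.prod_comp (finRotate m ^ j) fun k => G (x k) (x k)
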